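/- Let $\lambda_-<\lambda_+$ and let $\Lambda\in C^2(\mathbb R,(\lambda_-,\lambda_+))$ satisfy $\Lambda(s)\to\lambda_\pm$ and $\Lambda'(s)\to 0$ as $s\to\pm\infty$ (a \emph{parameter shift}). Let $a,b:[\lambda_-,\lambda_+]\to\mathbb R$ be $C^2$ functions with $b(\lambda)>-1$ and $|a(\lambda)|<\sqrt{b(\lambda)+1}$ for all $\lambda\in[\lambda_-,\lambda_+]$. For $x=(x_1,x_2)\in\mathbb R^2$ put $$F(x,\lambda)=\bigl(-x_1^3+a(\lambda)x_1^2+b(\lambda)x_1-a(\lambda)(b(\lambda)+1)+x_2,\; x_1-x_2\bigr),$$ and for $r>0$ consider the system $\dot x=F(x,\Lambda(rt))$. Put $p_1(s)=-\sqrt{b(\Lambda(s))+1}\,(1,1)$ and $p_3(s)=\sqrt{b(\Lambda(s))+1}\,(1,1)$, with limits $p_{i\pm}=\lim_{s\to\pm\infty}p_i(s)$. \emph{Definitions.} An equilibrium of $\dot x=F(x,\lambda)$ is \emph{attracting} if all eigenvalues of the linearization have negative real part. A \emph{stable path} is a continuous path $(X(s),\Lambda(s))$ such that $X(s)$ is an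 attracting equilibrium of $\dot x=F(x,\Lambda(s))$ for every $s$, and such that the limits $X_\pm=\lim_{s\to\pm\infty}X(s)$ exist and are attracting equilibria of $\dot x=F(x,\lambda_\pm)$. The \emph{pullback attractor} to $X_-$ at rate $r$ is the unique trajectory $x^r:\mathbb R\to\mathbb R^2$ of $\dot x=F(x,\Lambda(rt))$ with $x^r(t)\to X_-$ as $t\to-\infty$. There is \emph{R-tipping} away from $X_-$ for $\Lambda$ at rate $r$ if the pullback attractor exists and $x^r(t)\not\to X_+$ as $t\to\infty$; there is \emph{no R-tipping} away from $(X_-,\lambda_-)$ if for every $r>0$ the pullback attractor exists and $x^r(t)\to X_+$ as $t\to\infty$. \emph{There can be R-tipping} away from $X_-$ if there is a $C^2$ function $\sigma:\mathbb R\to\mathbb R$ with $\sigma'>0$ and $\sigma(s)\to\pm\infty$ as $s\to\pm\infty$, such that $\tilde\Lambda=\Lambda\circ\sigma$ is again a parameter shift with limits $\lambda_\pm$, and for $\tilde\Lambda$ there is R-tipping away from $X_-$ at some rate $r>0$. The stable path $(X(s),\Lambda(s))$ is \emph{forward inflowing stable} if there are compact sets $K(s)\subset\mathbb R^2$, $s\in\mathbb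 R$, such that: $X(s)\in\operatorname{Int}K(s)$ for all $s$; $K(s_1)\subset K(s_2)$ for $s_1<s_2$; for $x\in\partial K(s)$ the vector $v=F(x,\Lambda(s))$ points strictly into $K(s)$, i.e. there is $\delta>0$ with $x+hw\in K(s)$ whenever $0<h<\delta$ and $|w-v|<\delta$; with $K_-=\bigcap_s K(s)$ and $K_+=\overline{\bigcup_s K(s)}$ one has $X_\pm\in\operatorname{Int}K_\pm$; and $K_+$ is compact and contained in the basin of attraction of $X_+$ for $\dot x=F(x,\lambda_+)$. \emph{Claim.} \begin{enumerate} \item If there are $s_1<s_2$ with $-\sqrt{b(\Lambda(s_1))+1}>a(\Lambda(s_2))$ (resp. $\sqrt{b(\Lambda(s_1))+1}<a(\Lambda(s_2))$), then $(p_1(s),\Lambda(s))$ (resp. $(p_3(s),\Lambda(s))$) is a stable path and there can be R-tipping away from $p_{1-}$ (resp. $p_{3-}$). \item If $-\sqrt{b(\Lambda(s_1))+1}<a(\Lambda(s_2))$ (resp. $\sqrt{b(\Lambda(s_1))+1}>a(\Lambda(s_2))$) for all $-\infty\le s_1<s_2\le+\infty$, where $\Lambda(\pm\infty)=\lambda_\pm$,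 then $(p_1(s),\Lambda(s))$ (resp. $(p_3(s),\Lambda(s))$) is forward inflowing stable and there is no R-tipping away from $(p_{1-},\lambda_-)$ (resp. $(p_{3-},\lambda_-)$). \end{enumerate} -/

import Mathlib

open Filter Topology Set

noncomputable section

namespace RTipping

section General

variable {E : Type*} [NormedAddCommGroup E] [NormedSpace ℝ E]

/-- A parameter shift: a `C²` map `Λ : ℝ → (lm, lp)` with `Λ(s) → lm, lp` and `Λ'(s) → 0`
as `s → -∞, +∞`. -/
structure IsParameterShift (Λ : ℝ → ℝ) (lm lp : ℝ) : Prop where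
  contDiff : ContDiff ℝ 2 Λ
  mem_Ioo : ∀ s, Λ s ∈ Ioo lm lp
  tendsto_atBot : Tendsto Λ atBot (𝓝 lm)
  tendsto_atTop : Tendsto Λ atTop (𝓝 lp)
  deriv_atBot : Tendsto (deriv Λ) atBot (𝓝 0)
  deriv_atTop : Tendsto (deriv Λ) atTop (𝓝 0)

/-- `σ` is an admissible change of time scale: an increasing `C²` diffeomorphism of `ℝ`. -/
structure IsRescaling (σ : ℝ → ℝ) : Prop where
  contDiff : ContDiff ℝ 2 σ
  deriv_pos : ∀ s, 0 < deriv σ s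
  tendsto_atBot : Tendsto σ atBot atBot
  tendsto_atTop : Tendsto σ atTop atTop

/-- `x` is an attracting equilibrium of `ẋ = f(x, l)`: a zero of `f(·, l)` at which all (complex)
eigenvalues of the linearization have negative real part. -/
def IsAttractingEquilibrium [FiniteDimensional ℝ E] (f : E → ℝ → E) (l : ℝ) (x : E) : Prop :=
  f x l = 0 ∧ ∃ A : E →L[ℝ] E, HasFDerivAt (fun y => f y l) A x ∧
    ∀ μ : ℂ, ((A : E →ₗ[ℝ] E).charpoly.map (algebraMap ℝ ℂ)).IsRoot μ → μ.re < 0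

/-- `(X(s), Λ(s))` is a stable path with end points `Xm`, `Xp`: a continuous path of attracting
equilibria which converges, as `s → -∞, +∞`, to attracting equilibria `Xm`, `Xp` of the limiting
systems. -/
structure IsStablePath [FiniteDimensional ℝ E] (f : E → ℝ → E) (Λ : ℝ → ℝ) (lm lp : ℝ)
    (X : ℝ → E) (Xm Xp : E) : Prop where
  continuous : Continuous X
  attracting : ∀ s, IsAttractingEquilibrium f (Λ s) (X s)
  tendsto_atBot : Tendsto X atBot (𝓝 Xm)
  tendsto_atTop : Tendsto X atTop (𝓝 Xp)
  attracting_atBot : IsAttractingEquilibrium f lm Xm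
  attracting_atTop : IsAttractingEquilibrium f lp Xp

/-- The basin of attraction of `p` for `ẋ = f(x, l)`: the points whose forward solution exists for
all times `t ≥ 0` and converges to `p`. -/
def basin (f : E → ℝ → E) (l : ℝ) (p : E) : Set E :=
  {x₀ | ∃ φ : ℝ → E, φ 0 = x₀ ∧
    (∀ t, 0 ≤ t → HasDerivWithinAt φ (f (φ t) l) (Ici 0) t) ∧ Tendsto φ atTop (𝓝 p)}

/-- The vector `v`, attached at `x`, points strictly into `K`: moving a short way from `x` along
any direction close to `v` leads into `K`. -/
def PointsStrictlyInto (K : Set E) (x v : E) : Prop :=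
  ∃ δ > 0, ∀ h ∈ Ioo (0 : ℝ) δ, ∀ w ∈ Metric.ball v δ, x + h • w ∈ K

/-- Forward inflowing stability of the stable path `(X(s), Λ(s))`. -/
def IsForwardInflowingStable [FiniteDimensional ℝ E] (f : E → ℝ → E) (Λ : ℝ → ℝ) (lm lp : ℝ)
    (X : ℝ → E) (Xm Xp : E) : Prop :=
  IsStablePath f Λ lm lp X Xm Xp ∧
  ∃ K : ℝ → Set E,
    (∀ s, IsCompact (K s)) ∧
    (∀ s, X s ∈ interior (K s)) ∧
    (∀ s₁ s₂, s₁ < s₂ → K s₁ ⊆ K s₂) ∧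
    (∀ s, ∀ x ∈ frontier (K s), PointsStrictlyInto (K s) x (f x (Λ s))) ∧
    Xm ∈ interior (⋂ s, K s) ∧
    Xp ∈ interior (closure (⋃ s, K s)) ∧
    IsCompact (closure (⋃ s, K s)) ∧
    closure (⋃ s, K s) ⊆ basin f lp Xp

/-- `x` is a trajectory of `ẋ = f(x, Λ(rt))`, defined for all times, with `x(t) → Xm` as
`t → -∞`. -/
def EmanatesFrom (f : E → ℝ → E) (Λ : ℝ → ℝ) (r : ℝ) (Xm : E) (x : ℝ → E) : Prop :=
  (∀ t, HasDerivAt x (f (x t) (Λ (r * t))) t) ∧ Tendsto x atBot (𝓝 Xm)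

/-- `x` is the local pullback attractor to `Xm` of `ẋ = f(x, Λ(rt))`: the unique trajectory
with `x(t) → Xm` as `t → -∞`. -/
def IsPullbackAttractor (f : E → ℝ → E) (Λ : ℝ → ℝ) (r : ℝ) (Xm : E) (x : ℝ → E) : Prop :=
  EmanatesFrom f Λ r Xm x ∧ ∀ y, EmanatesFrom f Λ r Xm y → y = x

/-- R-tipping away from `Xm` for the parameter shift `Λ` at the rate `r`: the pullback
attractor to `Xm` exists and does not converge to `Xp`. -/
def RTips (f : E → ℝ → E) (Λ : ℝ → ℝ) (r : ℝ) (Xm Xp : E) : Prop :=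
  ∃ x, IsPullbackAttractor f Λ r Xm x ∧ ¬ Tendsto x atTop (𝓝 Xp)

/-- Endpoint tracking for the parameter shift `Λ` at the rate `r`: the pullback attractor to
`Xm` exists and converges to `Xp`. -/
def EndpointTracks (f : E → ℝ → E) (Λ : ℝ → ℝ) (r : ℝ) (Xm Xp : E) : Prop :=
  ∃ x, IsPullbackAttractor f Λ r Xm x ∧ Tendsto x atTop (𝓝 Xp)

/-- There can be R-tipping away from the stable path `(X(s), Λ(s))`: some rescaling `Λ ∘ σ` of
the parameter shift is a parameter shift for which there is R-tipping at some rate `r > 0`. -/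
def RTippingPossible [FiniteDimensional ℝ E] (f : E → ℝ → E) (Λ : ℝ → ℝ) (lm lp : ℝ)
    (X : ℝ → E) (Xm Xp : E) : Prop :=
  IsStablePath f Λ lm lp X Xm Xp ∧
  ∃ σ : ℝ → ℝ, IsRescaling σ ∧ IsParameterShift (Λ ∘ σ) lm lp ∧
    ∃ r > 0, RTips f (Λ ∘ σ) r Xm Xp

/-- There is no R-tipping: the pullback attractor endpoint tracks at every rate `r > 0`. -/
def NoRTipping (f : E → ℝ → E) (Λ : ℝ → ℝ) (Xm Xp : E) : Prop :=
  ∀ r > 0, EndpointTracks f Λ r Xm Xp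

end General

/-- The planar vector field `F(x, l)`, with coefficients `a(l)` and `b(l)`. -/
def F (a b : ℝ → ℝ) (x : EuclideanSpace ℝ (Fin 2)) (l : ℝ) : EuclideanSpace ℝ (Fin 2) :=
  !₂[-(x 0) ^ 3 + a l * (x 0) ^ 2 + b l * x 0 - a l * (b l + 1) + x 1, x 0 - x 1]

/-- The lower equilibrium `p₁ = (-√(b+1), -√(b+1))`. -/
def p₁ (b : ℝ → ℝ) (l : ℝ) : EuclideanSpace ℝ (Fin 2) :=
  !₂[-√(b l + 1), -√(b l + 1)]

/-- The upper equilibrium `p₃ = (√(b+1), √(b+1))`. -/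
def p₃ (b : ℝ → ℝ) (l : ℝ) : EuclideanSpace ℝ (Fin 2) :=
  !₂[√(b l + 1), √(b l + 1)]

end RTipping

end

/-!
With frozen coefficients the field is `(g(x₁) - x₁ + x₂, x₁ - x₂)`, where
`g(u) = -(u - a)(u² - (b + 1))`. Wherever `g(q) < 0`, the quadrant `{x₁ ≤ q, x₂ ≤ q + e}` is
strictly inflowing for small `e > 0`.

If `-√(b(Λ s₁) + 1) < a(Λ s₂)` for all `s₁ < s₂`, a nondecreasing function fits between the two
curves; the boxes whose upper corner follows it are inflowing, nested, and contained in the basin of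
the limiting equilibrium, so they trap the pullback attractor of `p₁`. If instead
`√(b(Λ s₁) + 1) < a(Λ s₂)` for some `s₁ < s₂`, a path which drifts slowly up to `s₁`, rushes to `s₂`
and then drifts slowly again leaves the trajectory that has been tracking `p₃` below the saddle
`(a, a)`, and the quadrants bounded by a curve just below the saddle keep it there.

The symmetry `x ↦ -x`, `a ↦ -a` exchanges `p₁` and `p₃`. Existence and uniqueness of the pullback
attractor come from a one-sided Lipschitz bound: the linearization is symmetric, so near an
attracting equilibrium the Euclidean distance between two trajectories decays exponentially.
-/

noncomputable section

namespace RTipping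

section Trapping

lemma mem_of_forall_Ico_mem {X : Type*} [TopologicalSpace X] {K : ℝ → Set X} (hmono : Monotone K)
    {γ : ℝ → X} {t₀ t : ℝ} (hclosed : IsClosed (K t)) (ht : t₀ < t)
    (hγ : ContinuousWithinAt γ (Icc t₀ t) t) (h : ∀ u ∈ Ico t₀ t, γ u ∈ K u) : γ t ∈ K t := by
  have : (𝓝[Ico t₀ t] t).NeBot := by
    rw [← mem_closure_iff_nhdsWithin_neBot, closure_Ico ht.ne]
    exact right_mem_Icc.2 ht.le
  refine hclosed.mem_of_tendsto (hγ.mono_left (nhdsWithin_mono t Ico_subset_Icc_self)) ?_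
  filter_upwards [self_mem_nhdsWithin] with u hu using hmono hu.2.le (h u hu)

variable {E : Type*} [NormedAddCommGroup E] [NormedSpace ℝ E] {K L : Set E} {x v : E}

lemma pointsStrictlyInto_iff_eventually :
    PointsStrictlyInto K x v ↔ ∀ᶠ p : ℝ × E in 𝓝[>] 0 ×ˢ 𝓝 v, x + p.1 • p.2 ∈ K := by
  constructor
  · rintro ⟨δ, hδ, h⟩
    filter_upwards [prod_mem_prod (Ioo_mem_nhdsGT hδ) (Metric.ball_mem_nhds v hδ)] with p hp
    exact h p.1 hp.1 p.2 hp.2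
  · intro h
    obtain ⟨⟨δ₁, δ₂⟩, ⟨h₁, h₂⟩, hK⟩ :=
      ((nhdsGT_basis (0 : ℝ)).prod Metric.nhds_basis_ball).eventually_iff.1 h
    refine ⟨min δ₁ δ₂, lt_min h₁ h₂, fun t ht w hw => hK (x := (t, w)) ⟨?_, ?_⟩⟩
    · exact ⟨ht.1, ht.2.trans_le (min_le_left _ _)⟩
    · exact Metric.ball_subset_ball (min_le_right _ _) hw

lemma PointsStrictlyInto.inter (hK : PointsStrictlyInto K x v) (hL : PointsStrictlyInto L x v) :
    PointsStrictlyInto (K ∩ L) x v := by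
  rw [pointsStrictlyInto_iff_eventually] at *
  exact hK.and hL

lemma pointsStrictlyInto_of_mem_interior (hx : x ∈ interior K) : PointsStrictlyInto K x v := by
  rw [pointsStrictlyInto_iff_eventually, ← nhdsWithin_univ v, ← nhdsWithin_prod_eq]
  have hc : ContinuousAt (fun p : ℝ × E => x + p.1 • p.2) (0, v) := by fun_prop
  exact (hc.tendsto.mono_left nhdsWithin_le_nhds) (by simpa using mem_interior_iff_mem_nhds.1 hx)

lemma pointsStrictlyInto_sublevel {g : E → ℝ} {φ : E →L[ℝ] ℝ} {k : ℝ} (hg : HasFDerivAt g φ x)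
    (hle : g x ≤ k) (hφ : g x = k → φ v < 0) : PointsStrictlyInto {y | g y ≤ k} x v := by
  rcases hle.lt_or_eq with hlt | heq
  · exact pointsStrictlyInto_of_mem_interior <| mem_interior_iff_mem_nhds.2 <|
      (hg.continuousAt.eventually_lt_const hlt).mono fun _ => le_of_lt
  rw [pointsStrictlyInto_iff_eventually]
  have hpos : ∀ᶠ p : ℝ × E in 𝓝[>] 0 ×ˢ 𝓝 v, 0 < p.1 :=
    (eventually_mem_nhdsWithin (s := Ioi (0 : ℝ))).prod_inl _
  have hslope : Tendsto (fun p : ℝ × E => p.1⁻¹ • (g (x + p.1 • p.2) - g x))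
      (𝓝[>] 0 ×ˢ 𝓝 v) (𝓝 (φ v)) := by
    have hsmul : Tendsto (fun p : ℝ × E => p.1 • p.2) (𝓝[>] 0 ×ˢ 𝓝 v) (𝓝 0) := by
      simpa using (tendsto_nhds_of_tendsto_nhdsWithin
        (tendsto_fst (f := 𝓝[>] (0 : ℝ)))).smul (tendsto_snd (g := 𝓝 v))
    refine hg.hasFDerivWithinAt.lim (s := univ) hsmul (by simp) (tendsto_snd.congr' ?_)
    filter_upwards [hpos] with p hp using (inv_smul_smul₀ hp.ne' _).symm
  filter_upwards [hslope.eventually_lt_const (hφ heq), hpos] with p hp h0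
  have := (smul_neg_iff_of_pos_left (inv_pos.2 h0)).1 hp
  exact (by linarith : g (x + p.1 • p.2) ≤ k)

lemma PointsStrictlyInto.eventually_mem {γ : ℝ → E} {t : ℝ} (h : PointsStrictlyInto K (γ t) v)
    (hγ : HasDerivWithinAt γ v (Ioi t) t) : ∀ᶠ s in 𝓝[>] t, γ s ∈ K := by
  rw [pointsStrictlyInto_iff_eventually] at h
  have hsub : Tendsto (fun s => s - t) (𝓝[>] t) (𝓝[>] 0) := by
    refine tendsto_nhdsWithin_iff.2 ⟨?_, ?_⟩
    · exact ((continuous_sub_right t).tendsto' t 0 (sub_self t)).mono_left nhdsWithin_le_nhds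
    · filter_upwards [self_mem_nhdsWithin] with s hs using sub_pos.2 (mem_Ioi.1 hs)
  have hslope : Tendsto (slope γ t) (𝓝[>] t) (𝓝 v) := by
    simpa using hasDerivWithinAt_iff_tendsto_slope.1 hγ
  filter_upwards [(hsub.prodMk hslope).eventually h] with s hs
  simpa [sub_smul_slope] using hs

lemma mem_of_pointsStrictlyInto {K : ℝ → Set E} (hmono : Monotone K)
    (hclosed : ∀ t, IsClosed (K t)) {γ γ' : ℝ → E} {t₀ t₁ : ℝ}
    (hγ : ∀ t ∈ Icc t₀ t₁, HasDerivWithinAt γ (γ' t) (Icc t₀ t₁) t)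
    (hK : ∀ t ∈ Ico t₀ t₁, γ t ∈ frontier (K t) → PointsStrictlyInto (K t) (γ t) (γ' t))
    (h₀ : γ t₀ ∈ K t₀) : ∀ t ∈ Icc t₀ t₁, γ t ∈ K t := by
  set S : Set ℝ := {t | ∀ u ∈ Icc t₀ t, γ u ∈ K u}
  have hS : IsClosed (S ∩ Icc t₀ t₁) := by
    refine isClosed_of_closure_subset fun t ht => ?_
    have htI : t ∈ Icc t₀ t₁ := closure_minimal inter_subset_right isClosed_Icc ht
    have hlt : ∀ u ∈ Ico t₀ t, γ u ∈ K u := by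
      intro u hu
      obtain ⟨w, hw, hwS⟩ := mem_closure_iff_nhds.1 ht _ (Ioi_mem_nhds hu.2)
      exact hwS.1 u ⟨hu.1, le_of_lt hw⟩
    refine ⟨fun u hu => ?_, htI⟩
    rcases hu.2.lt_or_eq with h | rfl
    · exact hlt u ⟨hu.1, h⟩
    rcases hu.1.eq_or_lt with rfl | h
    · exact h₀
    · exact mem_of_forall_Ico_mem hmono (hclosed u) h
        ((hγ u htI).continuousWithinAt.mono (Icc_subset_Icc_right htI.2)) hlt
  have hgt : ∀ t ∈ S ∩ Ico t₀ t₁, S ∈ 𝓝[>] t := by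
    rintro t ⟨htS, ht⟩
    have hmem : γ t ∈ K t := htS t ⟨ht.1, le_rfl⟩
    have hinto : PointsStrictlyInto (K t) (γ t) (γ' t) := by
      by_cases hint : γ t ∈ interior (K t)
      · exact pointsStrictlyInto_of_mem_interior hint
      · exact hK t ht ⟨subset_closure hmem, hint⟩
    have hev := hinto.eventually_mem ((hγ t (Ico_subset_Icc_self ht)).mono_of_mem_nhdsWithin
      (Icc_mem_nhdsGT_of_mem ht))
    obtain ⟨u, hu, hsub⟩ := (mem_nhdsGT_iff_exists_Ioc_subset).1 hev
    refine mem_of_superset (Ioc_mem_nhdsGT hu) fun s hs w hw => ?_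
    rcases le_or_gt w t with h | h
    · exact htS w ⟨hw.1, h⟩
    · exact hmono h.le (hsub ⟨h, hw.2.trans hs.2⟩)
  have h₀S : t₀ ∈ S := fun u hu => le_antisymm hu.1 hu.2 ▸ h₀
  exact fun t ht => hS.Icc_subset_of_forall_mem_nhdsWithin h₀S hgt ht t (right_mem_Icc.2 ht.1)

end Trapping

section GlobalSolutions

variable {E : Type*} [NormedAddCommGroup E] [NormedSpace ℝ E]

lemma exists_isIntegralCurve_of_forall_nat {f : ℝ → E → E} {K : NNReal}
    (hK : ∀ t, LipschitzWith K (f t)) {t₀ : ℝ} {x₀ : E}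
    (h : ∀ n : ℕ, ∃ γ : ℝ → E, γ t₀ = x₀ ∧
      IsIntegralCurveOn γ f (Ioo (t₀ - (n + 1)) (t₀ + (n + 1)))) :
    ∃ γ : ℝ → E, γ t₀ = x₀ ∧ IsIntegralCurve γ f := by
  choose γ hγ₀ hγ using h
  have hderiv : ∀ n : ℕ, ∀ t ∈ Ioo (t₀ - (n + 1)) (t₀ + (n + 1)),
      HasDerivAt (γ n) (f t (γ n t)) t :=
    fun n t ht => (hγ n t ht).hasDerivAt (Ioo_mem_nhds ht.1 ht.2)
  have hmono : ∀ m n : ℕ, m ≤ n →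
      Ioo (t₀ - (m + 1)) (t₀ + (m + 1)) ⊆ Ioo (t₀ - (n + 1)) (t₀ + (n + 1)) := by
    intro m n hmn
    have : (m : ℝ) ≤ n := by exact_mod_cast hmn
    exact Ioo_subset_Ioo (by linarith) (by linarith)
  have heq : ∀ m n : ℕ, m ≤ n → EqOn (γ m) (γ n) (Ioo (t₀ - (m + 1)) (t₀ + (m + 1))) := by
    intro m n hmn
    refine ODE_solution_unique_of_mem_Ioo (v := f) (s := fun _ => univ) (K := K) (t₀ := t₀)
      (fun t _ => (hK t).lipschitzOnWith) ?_ (fun t ht => ⟨hderiv m t ht, trivial⟩)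
      (fun t ht => ⟨hderiv n t (hmono m n hmn ht), trivial⟩) (by rw [hγ₀, hγ₀])
    constructor <;> linarith [m.cast_nonneg (α := ℝ)]
  have hceil : ∀ t, t ∈ Ioo (t₀ - (⌈|t - t₀|⌉₊ + 1 : ℝ)) (t₀ + (⌈|t - t₀|⌉₊ + 1)) := by
    intro t
    have := abs_le.1 (Nat.le_ceil |t - t₀|)
    constructor <;> linarith
  refine ⟨fun t => γ ⌈|t - t₀|⌉₊ t, hγ₀ _, fun t => ?_⟩
  refine (hderiv _ t (hceil t)).congr_of_eventuallyEq ?_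
  filter_upwards [Ioo_mem_nhds (hceil t).1 (hceil t).2] with s hs
  rcases le_total ⌈|s - t₀|⌉₊ ⌈|t - t₀|⌉₊ with h | h
  · exact heq _ _ h (hceil s)
  · exact (heq _ _ h hs).symm

lemma exists_isIntegralCurve_of_bounded [CompleteSpace E] {f : ℝ → E → E} {K L : NNReal}
    (hK : ∀ t, LipschitzWith K (f t)) (hc : ∀ x, Continuous fun t => f t x)
    (hL : ∀ t x, ‖f t x‖ ≤ L) (t₀ : ℝ) (x₀ : E) :
    ∃ γ : ℝ → E, γ t₀ = x₀ ∧ IsIntegralCurve γ f := by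
  refine exists_isIntegralCurve_of_forall_nat hK fun n => ?_
  have hPL : IsPicardLindelof f (tmin := t₀ - (n + 1)) (tmax := t₀ + (n + 1))
      ⟨t₀, by constructor <;> linarith [n.cast_nonneg (α := ℝ)]⟩ x₀ (L * (n + 1)) 0 L K :=
    { lipschitzOnWith := fun t _ => (hK t).lipschitzOnWith
      continuousOn := fun x _ => (hc x).continuousOn
      norm_le := fun t _ x _ => hL t x
      mul_max_le := by simp }
  obtain ⟨γ, hγ₀, hγ⟩ := hPL.exists_eq_forall_mem_Icc_hasDerivWithinAt₀
  exact ⟨γ, hγ₀, IsIntegralCurveOn.mono hγ Ioo_subset_Icc_self⟩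

/-- The radial retraction of a normed space onto the closed ball of radius `R` about `0`. -/
def radialRetraction (R : ℝ) (x : E) : E := (R / max R ‖x‖) • x

variable {R : ℝ}

lemma radialRetraction_of_norm_le (hR : 0 < R) {x : E} (hx : ‖x‖ ≤ R) :
    radialRetraction R x = x := by
  rw [radialRetraction, max_eq_left hx, div_self hR.ne', one_smul]

lemma norm_radialRetraction_le (hR : 0 < R) (x : E) : ‖radialRetraction R x‖ ≤ R := by
  have hmax : 0 < max R ‖x‖ := hR.trans_le (le_max_left _ _)
  rw [radialRetraction, norm_smul, Real.norm_of_nonneg (by positivity), div_mul_eq_mul_div,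
    div_le_iff₀ hmax]
  exact mul_le_mul_of_nonneg_left (le_max_right _ _) hR.le

lemma lipschitzWith_radialRetraction (hR : 0 < R) :
    LipschitzWith 2 (radialRetraction R : E → E) := by
  refine LipschitzWith.of_dist_le_mul fun x y => ?_
  have hx : 0 < max R ‖x‖ := hR.trans_le (le_max_left _ _)
  have hy : 0 < max R ‖y‖ := hR.trans_le (le_max_left _ _)
  have hmax : |max R ‖y‖ - max R ‖x‖| ≤ ‖x - y‖ := by
    rw [abs_sub_comm]
    exact (abs_max_sub_max_le_max R ‖x‖ R ‖y‖).trans (by simpa using abs_norm_sub_norm_le x y)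
  have hle : R / max R ‖x‖ ≤ 1 := (div_le_one hx).2 (le_max_left _ _)
  have hcoef : R / max R ‖x‖ - R / max R ‖y‖ =
      R / max R ‖x‖ * ((max R ‖y‖ - max R ‖x‖) / max R ‖y‖) := by field_simp
  have hsplit : radialRetraction R x - radialRetraction R y =
      (R / max R ‖x‖) • (x - y) + (R / max R ‖x‖ - R / max R ‖y‖) • y := by
    simp only [radialRetraction]; module
  have hsnd : ‖(R / max R ‖x‖ - R / max R ‖y‖) • y‖ ≤ ‖x - y‖ := by
    rw [hcoef, norm_smul, norm_mul, Real.norm_of_nonneg (by positivity : 0 ≤ R / max R ‖x‖),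
      Real.norm_eq_abs, abs_div, abs_of_pos hy]
    calc R / max R ‖x‖ * (|max R ‖y‖ - max R ‖x‖| / max R ‖y‖) * ‖y‖
        ≤ 1 * (‖x - y‖ / max R ‖y‖) * max R ‖y‖ := by
          gcongr; exact le_max_right _ _
      _ = ‖x - y‖ := by field_simp
  rw [dist_eq_norm, dist_eq_norm, hsplit, NNReal.coe_ofNat]
  refine (norm_add_le _ _).trans ?_
  rw [norm_smul, Real.norm_of_nonneg (by positivity)]
  nlinarith [norm_nonneg (x - y)]

end GlobalSolutions

section ForwardSolutions

variable {E : Type*} [NormedAddCommGroup E] [InnerProductSpace ℝ E]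

lemma pointsStrictlyInto_closedBall {p x v : E} {ρ : ℝ} (hx : x ∈ Metric.closedBall p ρ)
    (hv : ‖x - p‖ = ρ → inner ℝ v (x - p) < 0) :
    PointsStrictlyInto (Metric.closedBall p ρ) x v := by
  have hρ : 0 ≤ ρ := Metric.nonneg_of_mem_closedBall hx
  have hball : Metric.closedBall p ρ = {y | ‖y - p‖ ^ 2 ≤ ρ ^ 2} := by
    ext y
    simp [dist_eq_norm, abs_of_nonneg hρ, sq_le_sq]
  rw [hball] at hx ⊢
  refine pointsStrictlyInto_sublevel ((hasFDerivAt_id x).sub_const p).norm_sq hx fun h => ?_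
  have hneg : inner ℝ (x - p) v < 0 := by
    rw [real_inner_comm]
    exact hv ((sq_eq_sq₀ (norm_nonneg _) hρ).1 h)
  simpa [← inner_sub_left] using mul_neg_of_pos_of_neg two_pos hneg

lemma exists_isIntegralCurveOn_of_inward [CompleteSpace E] {f : ℝ → E → E} {K : NNReal} {L R : ℝ}
    (hR : 0 < R) (hK : ∀ t, LipschitzOnWith K (f t) (Metric.closedBall 0 R))
    (hc : ∀ x, Continuous fun t => f t x) (hL : ∀ t, ∀ x ∈ Metric.closedBall 0 R, ‖f t x‖ ≤ L)
    (hin : ∀ t x, ‖x‖ = R → inner ℝ (f t x) x < 0) (t₀ : ℝ) {x₀ : E}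
    (hx₀ : x₀ ∈ Metric.closedBall 0 R) :
    ∃ γ : ℝ → E, γ t₀ = x₀ ∧ IsIntegralCurveOn γ f (Ici t₀) := by
  have hret : ∀ x : E, radialRetraction R x ∈ Metric.closedBall 0 R := fun x =>
    mem_closedBall_zero_iff.2 (norm_radialRetraction_le hR x)
  obtain ⟨γ, hγ₀, hγ⟩ := exists_isIntegralCurve_of_bounded
    (f := fun t x => f t (radialRetraction R x)) (L := L.toNNReal)
    (fun t => lipschitzOnWith_univ.1 ((hK t).comp
      (lipschitzWith_radialRetraction hR).lipschitzOnWith fun x _ => hret x))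
    (fun x => hc _) (fun t x => (hL t _ (hret x)).trans (Real.le_coe_toNNReal L)) t₀ x₀
  have hball : ∀ t ∈ Ici t₀, γ t ∈ Metric.closedBall 0 R := fun t ht =>
    mem_of_pointsStrictlyInto (K := fun _ => Metric.closedBall 0 R) monotone_const
      (fun _ => Metric.isClosed_closedBall) (fun s _ => (hγ s).hasDerivWithinAt)
      (fun s _ hs => pointsStrictlyInto_closedBall (Metric.isClosed_closedBall.frontier_subset hs)
        fun h => by
          rw [sub_zero] at h ⊢
          simpa only [radialRetraction_of_norm_le hR h.le] using hin s _ h)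
      (hγ₀ ▸ hx₀) t ⟨ht, le_rfl⟩
  refine ⟨γ, hγ₀, fun t ht => ?_⟩
  simpa only [radialRetraction_of_norm_le hR (mem_closedBall_zero_iff.1 (hball t ht))]
    using (hγ t).hasDerivWithinAt (s := Ici t₀)

end ForwardSolutions

section PullbackAttractor

variable {E : Type*} [NormedAddCommGroup E] [InnerProductSpace ℝ E]

/-- The one-sided Lipschitz condition with constant `C` on `s`. For negative `C` it says that the
flow of `g` contracts distances in `s` at the exponential rate `-C`. -/
def OneSidedLipschitzOn (C : ℝ) (g : E → E) (s : Set E) : Prop :=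
  ∀ x ∈ s, ∀ y ∈ s, inner ℝ (g x - g y) (x - y) ≤ C * ‖x - y‖ ^ 2

variable {f : ℝ → E → E} {C κ ρ T : ℝ} {p : E}

lemma OneSidedLipschitzOn.mono {g : E → E} {s s' : Set E} (h : OneSidedLipschitzOn C g s)
    (hs : s' ⊆ s) : OneSidedLipschitzOn C g s' :=
  fun x hx y hy => h x (hs hx) y (hs hy)

lemma dist_le_exp_mul_dist {s : Set E} {γ η : ℝ → E} {t₀ t₁ : ℝ}
    (hf : ∀ t ∈ Icc t₀ t₁, OneSidedLipschitzOn C (f t) s)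
    (hγ : IsIntegralCurveOn γ f (Icc t₀ t₁)) (hη : IsIntegralCurveOn η f (Icc t₀ t₁))
    (hγs : MapsTo γ (Icc t₀ t₁) s) (hηs : MapsTo η (Icc t₀ t₁) s) (h : t₀ ≤ t₁) :
    dist (γ t₁) (η t₁) ≤ Real.exp (C * (t₁ - t₀)) * dist (γ t₀) (η t₀) := by
  have hderiv : ∀ t ∈ Icc t₀ t₁, HasDerivWithinAt (fun t => ‖γ t - η t‖ ^ 2)
      (2 * inner ℝ (γ t - η t) (f t (γ t) - f t (η t))) (Icc t₀ t₁) t :=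
    fun t ht => ((hγ t ht).sub (hη t ht)).norm_sq
  have hgronwall := le_gronwallBound_of_liminf_deriv_right_le (K := 2 * C) (ε := 0)
    (fun t ht => (hderiv t ht).continuousWithinAt)
    (fun t ht r hr => ((hderiv t (Ico_subset_Icc_self ht)).mono_of_mem_nhdsWithin
      (Icc_mem_nhdsGE_of_mem ht)).liminf_right_slope_le hr) le_rfl
    (fun t ht => by
      have := hf t (Ico_subset_Icc_self ht) _ (hγs (Ico_subset_Icc_self ht)) _
        (hηs (Ico_subset_Icc_self ht))
      rw [real_inner_comm] at this
      linarith) t₁ ⟨h, le_rfl⟩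
  rw [gronwallBound_ε0] at hgronwall
  rw [dist_eq_norm, dist_eq_norm]
  refine (sq_le_sq₀ (norm_nonneg _) (by positivity)).1 (hgronwall.trans_eq ?_)
  rw [mul_pow, ← Real.exp_nat_mul, mul_comm]
  push_cast
  ring_nf

lemma mem_closedBall_of_contracting {γ : ℝ → E} {t₀ t₁ : ℝ} (hρ : 0 < ρ)
    (hf : ∀ t ∈ Ico t₀ t₁, OneSidedLipschitzOn (-κ) (f t) (Metric.closedBall p ρ))
    (hp : ∀ t ∈ Ico t₀ t₁, ‖f t p‖ < κ * ρ) (hγ : IsIntegralCurveOn γ f (Icc t₀ t₁))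
    (h₀ : γ t₀ ∈ Metric.closedBall p ρ) : ∀ t ∈ Icc t₀ t₁, γ t ∈ Metric.closedBall p ρ := by
  refine mem_of_pointsStrictlyInto (K := fun _ => Metric.closedBall p ρ) monotone_const
    (fun _ => Metric.isClosed_closedBall) hγ (fun t ht hfr => ?_) h₀
  have hball := Metric.isClosed_closedBall.frontier_subset hfr
  refine pointsStrictlyInto_closedBall hball fun hnorm => ?_
  have hcontr := hf t ht (γ t) hball p (Metric.mem_closedBall_self hρ.le)
  have hforce : inner ℝ (f t p) (γ t - p) < κ * ρ * ρ := by
    refine (real_inner_le_norm _ _).trans_lt ?_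
    rw [hnorm]
    exact mul_lt_mul_of_pos_right (hp t ht) hρ
  rw [inner_sub_left, hnorm] at hcontr
  linarith

lemma mem_closedBall_of_tendsto_atBot {γ : ℝ → E} (hρ : 0 < ρ)
    (hf : ∀ t ≤ T, OneSidedLipschitzOn (-κ) (f t) (Metric.closedBall p ρ))
    (hp : ∀ t ≤ T, ‖f t p‖ < κ * ρ) (hγ : IsIntegralCurve γ f)
    (hlim : Tendsto γ atBot (𝓝 p)) : ∀ t ≤ T, γ t ∈ Metric.closedBall p ρ := by
  intro t ht
  obtain ⟨s, hs, hst⟩ := ((hlim.eventually (Metric.closedBall_mem_nhds p hρ)).and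
    (eventually_le_atBot t)).exists
  exact mem_closedBall_of_contracting hρ (fun u hu => hf u (hu.2.le.trans ht))
    (fun u hu => hp u (hu.2.le.trans ht)) (hγ.isIntegralCurveOn _) hs t ⟨hst, le_rfl⟩

lemma eq_of_tendsto_atBot {γ η : ℝ → E} (hC : ∀ t, OneSidedLipschitzOn C (f t) univ)
    (hκ : 0 < κ) (hρ : 0 < ρ)
    (hf : ∀ t ≤ T, OneSidedLipschitzOn (-κ) (f t) (Metric.closedBall p ρ))
    (hp : ∀ t ≤ T, ‖f t p‖ < κ * ρ) (hγ : IsIntegralCurve γ f) (hη : IsIntegralCurve η f)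
    (hγp : Tendsto γ atBot (𝓝 p)) (hηp : Tendsto η atBot (𝓝 p)) : γ = η := by
  have hγball := mem_closedBall_of_tendsto_atBot hρ hf hp hγ hγp
  have hηball := mem_closedBall_of_tendsto_atBot hρ hf hp hη hηp
  have hle : ∀ t ≤ T, γ t = η t := by
    intro t ht
    have hdist : Tendsto (fun s => Real.exp (-κ * (t - s)) * dist (γ s) (η s)) atBot (𝓝 0) := by
      have hexp : Tendsto (fun s => Real.exp (-κ * (t - s))) atBot (𝓝 0) :=
        Real.tendsto_exp_atBot.comp <| ((tendsto_atBot_add_const_right _ (-κ * t)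
          (tendsto_id.const_mul_atBot hκ)).congr fun s => by simp only [id_eq]; ring)
      simpa using hexp.mul (hγp.dist hηp)
    refine dist_le_zero.1 (ge_of_tendsto hdist ?_)
    filter_upwards [eventually_le_atBot t] with s hs
    exact dist_le_exp_mul_dist (fun u hu => hf u (hu.2.trans ht)) (hγ.isIntegralCurveOn _)
      (hη.isIntegralCurveOn _) (fun u hu => hγball u (hu.2.trans ht))
      (fun u hu => hηball u (hu.2.trans ht)) hs
  funext t
  have := dist_le_exp_mul_dist (fun u _ => hC u) (hγ.isIntegralCurveOn _) (hη.isIntegralCurveOn _)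
    (mapsTo_univ _ _) (mapsTo_univ _ _) (min_le_left t T)
  rwa [hle _ (min_le_right t T), dist_self, mul_zero, dist_le_zero] at this

lemma isIntegralCurve_of_tendsto (hC : ∀ t, OneSidedLipschitzOn C (f t) univ)
    (hex : ∀ t₀ x₀, ∃ γ : ℝ → E, γ t₀ = x₀ ∧ IsIntegralCurveOn γ f (Ici t₀))
    {γ : ℕ → ℝ → E} (hγ : ∀ t, ∀ᶠ n in atTop, IsIntegralCurveOn (γ n) f (Ici t)) {x : ℝ → E}
    (hx : ∀ t, Tendsto (fun n => γ n t) atTop (𝓝 (x t))) : IsIntegralCurve x f := by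
  intro t
  obtain ⟨η, hη₀, hη⟩ := hex (t - 1) (x (t - 1))
  have heq : ∀ s ∈ Ici (t - 1), x s = η s := by
    intro s hs
    refine tendsto_nhds_unique (hx s) (tendsto_iff_dist_tendsto_zero.2 ?_)
    have hzero : Tendsto (fun n => Real.exp (C * (s - (t - 1))) * dist (γ n (t - 1)) (η (t - 1)))
        atTop (𝓝 0) := by
      simpa [hη₀] using (tendsto_iff_dist_tendsto_zero.1 (hx (t - 1))).const_mul _
    refine squeeze_zero' (.of_forall fun _ => dist_nonneg) ?_ hzero
    filter_upwards [hγ (t - 1)] with n hn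
    exact dist_le_exp_mul_dist (fun u _ => hC u) (hn.mono Icc_subset_Ici_self)
      (hη.mono Icc_subset_Ici_self) (mapsTo_univ _ _) (mapsTo_univ _ _) hs
  have hnhds : Ici (t - 1) ∈ 𝓝 t := Ici_mem_nhds (sub_one_lt t)
  have hderiv := (hη t (mem_of_mem_nhds hnhds)).hasDerivAt hnhds
  rw [← heq t (mem_of_mem_nhds hnhds)] at hderiv
  exact hderiv.congr_of_eventuallyEq (by filter_upwards [hnhds] with s hs using heq s hs)

lemma dist_le_of_contracting {γ η : ℝ → E} {t₀ t : ℝ}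
    (hC : ∀ t, OneSidedLipschitzOn C (f t) univ)
    (hf : ∀ t ≤ T, OneSidedLipschitzOn (-κ) (f t) (Metric.closedBall p ρ))
    (hγ : IsIntegralCurveOn γ f (Ici t₀)) (hη : IsIntegralCurveOn η f (Ici t₀))
    (hγball : ∀ u ∈ Icc t₀ T, γ u ∈ Metric.closedBall p ρ)
    (hηball : ∀ u ∈ Icc t₀ T, η u ∈ Metric.closedBall p ρ) (h : t₀ ≤ min t T) :
    dist (γ t) (η t) ≤
      Real.exp (C * (t - min t T)) * (Real.exp (-κ * (min t T - t₀)) * (2 * ρ)) := by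
  have hmem : ∀ u ∈ Icc t₀ (min t T), u ∈ Icc t₀ T := fun u hu =>
    ⟨hu.1, hu.2.trans (min_le_right t T)⟩
  have hstart : dist (γ t₀) (η t₀) ≤ 2 * ρ := by
    rw [two_mul]
    exact (dist_triangle_right _ _ p).trans (add_le_add (hγball t₀ (hmem t₀ ⟨le_rfl, h⟩))
      (hηball t₀ (hmem t₀ ⟨le_rfl, h⟩)))
  calc dist (γ t) (η t)
      ≤ Real.exp (C * (t - min t T)) * dist (γ (min t T)) (η (min t T)) :=
        dist_le_exp_mul_dist (fun u _ => hC u)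
          (hγ.mono (Icc_subset_Ici_self.trans (Ici_subset_Ici.2 h)))
          (hη.mono (Icc_subset_Ici_self.trans (Ici_subset_Ici.2 h)))
          (mapsTo_univ _ _) (mapsTo_univ _ _) (min_le_left t T)
    _ ≤ Real.exp (C * (t - min t T)) *
        (Real.exp (-κ * (min t T - t₀)) * dist (γ t₀) (η t₀)) := by
        gcongr
        exact dist_le_exp_mul_dist (fun u hu => hf u (hmem u hu).2)
          (hγ.mono Icc_subset_Ici_self) (hη.mono Icc_subset_Ici_self)
          (fun u hu => hγball u (hmem u hu)) (fun u hu => hηball u (hmem u hu)) h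
    _ ≤ _ := by gcongr

lemma cauchySeq_of_contracting (hC : ∀ t, OneSidedLipschitzOn C (f t) univ) (hκ : 0 < κ)
    (hf : ∀ t ≤ T, OneSidedLipschitzOn (-κ) (f t) (Metric.closedBall p ρ)) {γ : ℕ → ℝ → E}
    (hγ : ∀ n : ℕ, IsIntegralCurveOn (γ n) f (Ici (T - n)))
    (hball : ∀ n : ℕ, ∀ t ∈ Icc (T - n) T, γ n t ∈ Metric.closedBall p ρ) (t : ℝ) :
    CauchySeq fun n => γ n t := by
  set s := min t T
  have hbound : ∀ N : ℕ, T - s ≤ N → ∀ n ≥ N, ∀ m ≥ N, dist (γ n t) (γ m t) ≤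
      Real.exp (C * (t - s)) * (Real.exp (-κ * (s - (T - N))) * (2 * ρ)) := by
    intro N hN n hn m hm
    have hsub : ∀ k ≥ N, T - (k : ℝ) ≤ T - N := fun k hk => by gcongr
    have hcurve : ∀ k ≥ N, IsIntegralCurveOn (γ k) f (Ici (T - N)) := fun k hk =>
      (hγ k).mono (Ici_subset_Ici.2 (hsub k hk))
    have hmaps : ∀ k ≥ N, ∀ u ∈ Icc (T - N) T, γ k u ∈ Metric.closedBall p ρ :=
      fun k hk u hu => hball k u ⟨(hsub k hk).trans hu.1, hu.2⟩
    exact dist_le_of_contracting hC hf (hcurve n hn) (hcurve m hm) (hmaps n hn) (hmaps m hm)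
      (by linarith)
  have hlim : Tendsto (fun N : ℕ => Real.exp (C * (t - s)) *
      (Real.exp (-κ * (s - (T - N))) * (2 * ρ))) atTop (𝓝 0) := by
    have hexp : Tendsto (fun N : ℕ => Real.exp (-κ * (s - (T - N)))) atTop (𝓝 0) :=
      Real.tendsto_exp_atBot.comp <| ((tendsto_atBot_add_const_right _ (-κ * (s - T))
        (tendsto_natCast_atTop_atTop.const_mul_atTop_of_neg (neg_lt_zero.2 hκ))).congr
          fun N => by ring)
    simpa using (hexp.mul_const (2 * ρ)).const_mul (Real.exp (C * (t - s)))
  refine Metric.cauchySeq_iff.2 fun ε hε => ?_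
  obtain ⟨N, hN, hNs⟩ := ((hlim.eventually_lt_const hε).and
    (eventually_ge_atTop ⌈T - s⌉₊)).exists
  exact ⟨N, fun n hn m hm => (hbound N (Nat.ceil_le.1 hNs) n hn m hm).trans_lt hN⟩

lemma exists_tendsto_atBot [CompleteSpace E] (hC : ∀ t, OneSidedLipschitzOn C (f t) univ)
    (hex : ∀ t₀ x₀, ∃ γ : ℝ → E, γ t₀ = x₀ ∧ IsIntegralCurveOn γ f (Ici t₀))
    (hκ : 0 < κ) (hρ : 0 < ρ)
    (hf : ∀ t ≤ T, OneSidedLipschitzOn (-κ) (f t) (Metric.closedBall p ρ))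
    (hp : ∀ t ≤ T, ‖f t p‖ < κ * ρ) (hp₀ : Tendsto (fun t => f t p) atBot (𝓝 0)) :
    ∃ γ : ℝ → E, IsIntegralCurve γ f ∧ Tendsto γ atBot (𝓝 p) := by
  choose γ hγp hγ using fun n : ℕ => hex (T - n) p
  have hball : ∀ ρ' ∈ Ioc 0 ρ, ∀ T' ≤ T, (∀ t ≤ T', ‖f t p‖ < κ * ρ') →
      ∀ n : ℕ, ∀ t ∈ Icc (T - n) T', γ n t ∈ Metric.closedBall p ρ' :=
    fun ρ' hρ' T' hT' hp' n => mem_closedBall_of_contracting hρ'.1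
      (fun t ht => (hf t (ht.2.le.trans hT')).mono (Metric.closedBall_subset_closedBall hρ'.2))
      (fun t ht => hp' t ht.2.le) ((hγ n).mono Icc_subset_Ici_self)
      (hγp n ▸ Metric.mem_closedBall_self hρ'.1.le)
  choose x hx using fun t => cauchySeq_tendsto_of_complete
    (cauchySeq_of_contracting hC hκ hf hγ (hball ρ ⟨hρ, le_rfl⟩ T le_rfl hp) t)
  have hstart : ∀ t, ∀ᶠ n : ℕ in atTop, T - n ≤ t := fun t => by
    filter_upwards [eventually_ge_atTop ⌈T - t⌉₊] with n hn
    linarith [Nat.ceil_le.1 hn]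
  refine ⟨x, isIntegralCurve_of_tendsto hC hex (fun t => ?_) hx, ?_⟩
  · filter_upwards [hstart t] with n hn using (hγ n).mono (Ici_subset_Ici.2 hn)
  refine (Metric.nhds_basis_closedBall.tendsto_right_iff).2 fun ε hε => ?_
  set ρ' := min ε ρ
  have hρ' : 0 < ρ' := lt_min hε hρ
  obtain ⟨T', hT'⟩ := eventually_atBot.1 ((hp₀.norm.eventually_lt_const
    (by simpa using mul_pos hκ hρ')).and (eventually_le_atBot T))
  filter_upwards [eventually_le_atBot T'] with t ht
  refine Metric.closedBall_subset_closedBall (min_le_left ε ρ)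
    (Metric.isClosed_closedBall.mem_of_tendsto (hx t) ?_)
  filter_upwards [hstart t] with n hn
  exact hball ρ' ⟨hρ', min_le_right ε ρ⟩ T' (hT' T' le_rfl).2 (fun s hs => (hT' s hs).1) n t
    ⟨hn, ht⟩

end PullbackAttractor

section Reflection

/-- The field conjugate to `f` under the point reflection `x ↦ -x` of the phase space. It reduces
statements on one of the equilibria `p₁`, `p₃` to statements on the other. -/
def reflect {E : Type*} [Neg E] (f : E → ℝ → E) (x : E) (l : ℝ) : E := -f (-x) l

lemma reflect_reflect {E : Type*} [InvolutiveNeg E] (f : E → ℝ → E) : reflect (reflect f) = f := by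
  funext x l
  simp only [reflect, neg_neg]

variable {E : Type*} [NormedAddCommGroup E] [NormedSpace ℝ E] {f : E → ℝ → E} {Λ : ℝ → ℝ}
  {l lm lp r : ℝ} {X : ℝ → E} {Xm Xp : E}

lemma IsAttractingEquilibrium.reflect [FiniteDimensional ℝ E] {x : E}
    (h : IsAttractingEquilibrium f l x) : IsAttractingEquilibrium (reflect f) l (-x) := by
  obtain ⟨hzero, A, hA, hspec⟩ := h
  refine ⟨by rw [RTipping.reflect, neg_neg, hzero, neg_zero], A, ?_, hspec⟩
  have hA' : HasFDerivAt (fun y => f y l) A (-(-x)) := by rwa [neg_neg]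
  refine (hA'.comp (-x) (hasFDerivAt_id (-x)).neg).neg.congr_fderiv ?_
  ext y
  simp

lemma IsStablePath.reflect [FiniteDimensional ℝ E] (h : IsStablePath f Λ lm lp X Xm Xp) :
    IsStablePath (reflect f) Λ lm lp (fun s => -X s) (-Xm) (-Xp) where
  continuous := h.continuous.neg
  attracting s := (h.attracting s).reflect
  tendsto_atBot := h.tendsto_atBot.neg
  tendsto_atTop := h.tendsto_atTop.neg
  attracting_atBot := h.attracting_atBot.reflect
  attracting_atTop := h.attracting_atTop.reflect

lemma EmanatesFrom.reflect {x : ℝ → E} (h : EmanatesFrom f Λ r Xm x) :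
    EmanatesFrom (reflect f) Λ r (-Xm) (-x) := by
  refine ⟨fun t => ?_, h.2.neg⟩
  rw [RTipping.reflect, Pi.neg_apply, neg_neg]
  exact (h.1 t).neg

lemma IsPullbackAttractor.reflect {x : ℝ → E} (h : IsPullbackAttractor f Λ r Xm x) :
    IsPullbackAttractor (reflect f) Λ r (-Xm) (-x) := by
  refine ⟨h.1.reflect, fun y hy => ?_⟩
  have hy' := hy.reflect
  rw [reflect_reflect, neg_neg] at hy'
  rw [← h.2 _ hy', neg_neg]

lemma RTips.reflect (h : RTips f Λ r Xm Xp) : RTips (reflect f) Λ r (-Xm) (-Xp) := by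
  obtain ⟨x, hx, hlim⟩ := h
  exact ⟨-x, hx.reflect, fun hneg => hlim (by simpa using hneg.neg)⟩

lemma RTippingPossible.reflect [FiniteDimensional ℝ E] (h : RTippingPossible f Λ lm lp X Xm Xp) :
    RTippingPossible (reflect f) Λ lm lp (fun s => -X s) (-Xm) (-Xp) := by
  obtain ⟨hX, σ, hσ, hΛσ, r, hr, htips⟩ := h
  exact ⟨hX.reflect, σ, hσ, hΛσ, r, hr, htips.reflect⟩

lemma NoRTipping.reflect (h : NoRTipping f Λ Xm Xp) : NoRTipping (reflect f) Λ (-Xm) (-Xp) := by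
  intro r hr
  obtain ⟨x, hx, hlim⟩ := h r hr
  exact ⟨-x, hx.reflect, hlim.neg⟩

lemma neg_mem_basin_reflect {p x : E} (h : x ∈ basin f l p) : -x ∈ basin (reflect f) l (-p) := by
  obtain ⟨φ, hφ₀, hφ, hlim⟩ := h
  refine ⟨-φ, by simp [hφ₀], fun t ht => ?_, hlim.neg⟩
  rw [RTipping.reflect, Pi.neg_apply, neg_neg]
  exact (hφ t ht).neg

lemma PointsStrictlyInto.reflect {K : Set E} {x v : E} (h : PointsStrictlyInto K (-x) v) :
    PointsStrictlyInto (Neg.neg ⁻¹' K) x (-v) := by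
  obtain ⟨δ, hδ, hK⟩ := h
  refine ⟨δ, hδ, fun s hs w hw => ?_⟩
  have hw' : -w ∈ Metric.ball v δ := by rwa [Metric.mem_ball, ← dist_neg_neg, neg_neg]
  simpa [add_comm] using hK s hs (-w) hw'

lemma IsForwardInflowingStable.reflect [FiniteDimensional ℝ E]
    (h : IsForwardInflowingStable f Λ lm lp X Xm Xp) :
    IsForwardInflowingStable (reflect f) Λ lm lp (fun s => -X s) (-Xm) (-Xp) := by
  obtain ⟨hX, K, hcompact, hint, hmono, hinto, hm, hp, hclosure, hbasin⟩ := h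
  have hinterior : ∀ S : Set E, interior (Neg.neg ⁻¹' S) = Neg.neg ⁻¹' interior S := fun S =>
    ((Homeomorph.neg E).preimage_interior S).symm
  have hfrontier : ∀ S : Set E, frontier (Neg.neg ⁻¹' S) = Neg.neg ⁻¹' frontier S := fun S =>
    ((Homeomorph.neg E).preimage_frontier S).symm
  have hunion : closure (⋃ s, Neg.neg ⁻¹' K s) = Neg.neg ⁻¹' closure (⋃ s, K s) := by
    rw [← preimage_iUnion]
    exact ((Homeomorph.neg E).preimage_closure _).symm
  refine ⟨hX.reflect, fun s => Neg.neg ⁻¹' K s,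
    fun s => (Homeomorph.neg E).isCompact_preimage.2 (hcompact s), fun s => ?_,
    fun s₁ s₂ hs => preimage_mono (hmono s₁ s₂ hs), fun s x hx => ?_, ?_, ?_, ?_, ?_⟩
  · rw [hinterior, mem_preimage, neg_neg]
    exact hint s
  · rw [hfrontier] at hx
    exact (hinto s _ hx).reflect
  · rw [← preimage_iInter, hinterior, mem_preimage, neg_neg]
    exact hm
  · rw [hunion, hinterior, mem_preimage, neg_neg]
    exact hp
  · rw [hunion]
    exact (Homeomorph.neg E).isCompact_preimage.2 hclosure
  · rw [hunion]
    intro x hx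
    simpa only [neg_neg] using neg_mem_basin_reflect (hbasin hx)

end Reflection

lemma reflect_F (a b : ℝ → ℝ) : reflect (F a b) = F (-a) b := by
  funext x l
  ext i
  fin_cases i <;> simp [reflect, F] <;> ring

lemma neg_p₁ (b : ℝ → ℝ) (l : ℝ) : -p₁ b l = p₃ b l := by
  ext i
  fin_cases i <;> simp [p₁, p₃]

lemma neg_p₃ (b : ℝ → ℝ) (l : ℝ) : -p₃ b l = p₁ b l := by rw [← neg_p₁, neg_neg]

section PlanarField

/-- The restriction of the first component of the field to the nullcline `x₁ = x₂` of the second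
one, with the coefficients `α`, `β` frozen: `-u³ + αu² + (β + 1)u - α(β + 1)`. -/
def cubic (α β u : ℝ) : ℝ := -(u - α) * (u ^ 2 - (β + 1))

/-- The slope of the secant of `cubic α β` through the points over `u` and `w`, or of its tangent
if `u = w`. -/
def cubicSlope (α β u w : ℝ) : ℝ := -(u ^ 2 + u * w + w ^ 2) + α * (u + w) + β + 1

/-- The planar field with the coefficients `α`, `β` frozen. -/
def planarField (α β : ℝ) (x : EuclideanSpace ℝ (Fin 2)) : EuclideanSpace ℝ (Fin 2) :=
  !₂[cubic α β (x 0) - x 0 + x 1, x 0 - x 1]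

variable {α β A B : ℝ} {x : EuclideanSpace ℝ (Fin 2)}

@[simp] lemma planarField_zero : planarField α β x 0 = cubic α β (x 0) - x 0 + x 1 := rfl

@[simp] lemma planarField_one : planarField α β x 1 = x 0 - x 1 := rfl

lemma F_eq_planarField (a b : ℝ → ℝ) (x : EuclideanSpace ℝ (Fin 2)) (l : ℝ) :
    F a b x l = planarField (a l) (b l) x := by
  ext i
  fin_cases i
  · simp [F, cubic]; ring
  · simp [F]

lemma cubic_sub_cubic (α β u w : ℝ) :
    cubic α β u - cubic α β w = cubicSlope α β u w * (u - w) := by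
  unfold cubic cubicSlope; ring

lemma inner_planarField_sub (α β : ℝ) (x y : EuclideanSpace ℝ (Fin 2)) :
    inner ℝ (planarField α β x - planarField α β y) (x - y) =
      cubicSlope α β (x 0) (y 0) * (x 0 - y 0) ^ 2 - ((x 0 - y 0) - (x 1 - y 1)) ^ 2 := by
  have := cubic_sub_cubic α β (x 0) (y 0)
  simp only [PiLp.inner_apply, PiLp.sub_apply, Fin.sum_univ_two, planarField_zero,
    planarField_one, RCLike.inner_apply, conj_trivial]
  linear_combination (x 0 - y 0) * this

lemma norm_sub_sq_fin_two (x y : EuclideanSpace ℝ (Fin 2)) :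
    ‖x - y‖ ^ 2 = (x 0 - y 0) ^ 2 + (x 1 - y 1) ^ 2 := by
  simp [EuclideanSpace.norm_sq_eq]

lemma cubicSlope_le (hα : |α| ≤ A) (hβ : β ≤ B) (u w : ℝ) :
    cubicSlope α β u w ≤ A ^ 2 + (B + 1) := by
  have : α ^ 2 ≤ A ^ 2 := sq_le_sq.2 (hα.trans (le_abs_self A))
  unfold cubicSlope
  nlinarith [sq_nonneg (u + w - α), sq_nonneg u, sq_nonneg w, sq_nonneg (u - α), sq_nonneg (w - α)]

lemma oneSidedLipschitzOn_planarField (hα : |α| ≤ A) (hβ : |β| ≤ B) :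
    OneSidedLipschitzOn (A ^ 2 + (B + 1)) (planarField α β) univ := by
  intro x _ y _
  have hB : 0 ≤ B := (abs_nonneg β).trans hβ
  rw [inner_planarField_sub, norm_sub_sq_fin_two]
  have := mul_le_mul_of_nonneg_right (cubicSlope_le hα ((le_abs_self β).trans hβ) (x 0) (y 0))
    (sq_nonneg (x 0 - y 0))
  have h1 : 0 ≤ (A ^ 2 + (B + 1)) * (x 1 - y 1) ^ 2 := by positivity
  linarith [sq_nonneg ((x 0 - y 0) - (x 1 - y 1))]

lemma sub_sq_le_of_slope_le {κ S a b : ℝ} (hκ : 0 ≤ κ) (hκ2 : κ ≤ 1 / 2) (hS : S ≤ -3 * κ) :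
    S * a ^ 2 - (a - b) ^ 2 ≤ -κ * (a ^ 2 + b ^ 2) := by
  have hslope : S * a ^ 2 ≤ -3 * κ * a ^ 2 := by gcongr
  have hdiff : 2 * κ * (a - b) ^ 2 ≤ 1 * (a - b) ^ 2 := by gcongr; linarith
  linarith [mul_nonneg hκ (sq_nonneg (2 * a - b))]

lemma eventually_contracting_planarField {p : EuclideanSpace ℝ (Fin 2)}
    (h : cubicSlope α β (p 0) (p 0) < 0) :
    ∃ κ > 0, ∃ ρ > 0, ∀ᶠ q in 𝓝 (α, β),
      OneSidedLipschitzOn (-κ) (planarField q.1 q.2) (Metric.closedBall p ρ) := by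
  obtain ⟨m, hm, hm0⟩ := exists_between h
  have hcont : Continuous fun z : (ℝ × ℝ) × EuclideanSpace ℝ (Fin 2) × EuclideanSpace ℝ (Fin 2) =>
      cubicSlope z.1.1 z.1.2 (z.2.1 0) (z.2.2 0) := by
    unfold cubicSlope; fun_prop
  have hev := (hcont.tendsto ((α, β), p, p)).eventually_lt_const hm
  rw [nhds_prod_eq, eventually_prod_iff] at hev
  obtain ⟨P, hP, Q, hQ, hPQ⟩ := hev
  obtain ⟨ρ, hρ, hball⟩ := Metric.nhds_basis_closedBall.mem_iff.1 hQ
  refine ⟨min (-m / 3) (1 / 2), lt_min (by linarith) (by norm_num), ρ, hρ, ?_⟩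
  filter_upwards [hP] with q hq x hx y hy
  rw [← closedBall_prod_same] at hball
  have hκm : min (-m / 3) (1 / 2) ≤ -m / 3 := min_le_left _ _
  have hκ : 0 < min (-m / 3) (1 / 2) := lt_min (by linarith) (by norm_num)
  rw [inner_planarField_sub, norm_sub_sq_fin_two]
  have hslope : cubicSlope q.1 q.2 (x 0) (y 0) < m := hPQ hq (hball (mk_mem_prod hx hy))
  exact sub_sq_le_of_slope_le hκ.le (min_le_right _ _) (by linarith)

lemma inner_planarField_self (α β : ℝ) (x : EuclideanSpace ℝ (Fin 2)) :
    inner ℝ (planarField α β x) x = x 0 * cubic α β (x 0) - (x 0 - x 1) ^ 2 := by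
  simp only [PiLp.inner_apply, Fin.sum_univ_two, planarField_zero, planarField_one,
    RCLike.inner_apply, conj_trivial]
  ring

lemma mul_cubic_le (hα : |α| ≤ A) (hβ : |β| ≤ B) (u : ℝ) :
    u * cubic α β u ≤
      ((A ^ 2 / 2 + B + 3) ^ 2 + A ^ 2 * (B + 1) ^ 2) / 2 - 3 / 2 * u ^ 2 := by
  have hα2 : α ^ 2 ≤ A ^ 2 := sq_le_sq.2 (hα.trans (le_abs_self A))
  have hβ1 : |β + 1| ≤ B + 1 := (abs_add_le β 1).trans (by simpa using hβ)
  have hβ2 : (β + 1) ^ 2 ≤ (B + 1) ^ 2 := sq_le_sq.2 (hβ1.trans (le_abs_self _))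
  have hprod : α ^ 2 * (β + 1) ^ 2 ≤ A ^ 2 * (B + 1) ^ 2 := by gcongr
  have hquad : (α ^ 2 / 2 + (β + 1)) * u ^ 2 ≤ (A ^ 2 / 2 + (B + 1)) * u ^ 2 := by
    gcongr
    exact (le_abs_self β).trans hβ
  have hcubic : u * cubic α β u = -u ^ 4 + α * u * u ^ 2 + (β + 1) * u ^ 2 - α * (β + 1) * u := by
    unfold cubic; ring
  rw [hcubic]
  linarith [two_mul_le_add_sq (α * u) (u ^ 2), two_mul_le_add_sq (α * (β + 1)) (-u),
    two_mul_le_add_sq (A ^ 2 / 2 + B + 3) (u ^ 2)]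

lemma inner_planarField_self_le (hα : |α| ≤ A) (hβ : |β| ≤ B) (x : EuclideanSpace ℝ (Fin 2)) :
    inner ℝ (planarField α β x) x ≤
      ((A ^ 2 / 2 + B + 3) ^ 2 + A ^ 2 * (B + 1) ^ 2) / 2 - ‖x‖ ^ 2 / 2 := by
  rw [inner_planarField_self, EuclideanSpace.norm_sq_eq, Fin.sum_univ_two, Real.norm_eq_abs,
    Real.norm_eq_abs, sq_abs, sq_abs]
  nlinarith [mul_cubic_le hα hβ (x 0), sq_nonneg (2 * x 0 - x 1)]

lemma contDiff_planarField : ContDiff ℝ 1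
    fun z : (ℝ × ℝ) × EuclideanSpace ℝ (Fin 2) => planarField z.1.1 z.1.2 z.2 := by
  have hcoord : ∀ i : Fin 2,
      ContDiff ℝ 1 fun z : (ℝ × ℝ) × EuclideanSpace ℝ (Fin 2) => z.2 i :=
    fun i => (EuclideanSpace.proj (𝕜 := ℝ) i).contDiff.comp contDiff_snd
  have h0 := hcoord 0
  have h1 := hcoord 1
  rw [contDiff_euclidean, Fin.forall_fin_two]
  simp only [planarField_zero, planarField_one, cubic]
  constructor <;> fun_prop

lemma exists_lipschitzOnWith_planarField (A B R : ℝ) :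
    ∃ K : NNReal, ∀ α β, |α| ≤ A → |β| ≤ B →
      LipschitzOnWith K (planarField α β) (Metric.closedBall 0 R) := by
  obtain ⟨K, hK⟩ := contDiff_planarField.locallyLipschitz.locallyLipschitzOn
    |>.exists_lipschitzOnWith_of_compact
      ((isCompact_Icc (a := -A) (b := A)).prod (isCompact_Icc (a := -B) (b := B)) |>.prod
        (isCompact_closedBall (0 : EuclideanSpace ℝ (Fin 2)) R))
  refine ⟨K, fun α β hα hβ => ?_⟩
  have h := hK.comp (LipschitzWith.prodMk_left (α, β)).lipschitzOnWith
    fun x hx => ⟨⟨abs_le.1 hα, abs_le.1 hβ⟩, hx⟩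
  rwa [mul_one] at h

lemma exists_norm_planarField_le (A B R : ℝ) :
    ∃ L, ∀ α β, |α| ≤ A → |β| ≤ B → ∀ x ∈ Metric.closedBall 0 R, ‖planarField α β x‖ ≤ L := by
  obtain ⟨L, hL⟩ := ((isCompact_Icc (a := -A) (b := A)).prod (isCompact_Icc (a := -B) (b := B))
    |>.prod (isCompact_closedBall (0 : EuclideanSpace ℝ (Fin 2)) R)).exists_bound_of_continuousOn
      contDiff_planarField.continuous.continuousOn
  exact ⟨L, fun α β hα hβ x hx => hL ((α, β), x) ⟨⟨abs_le.1 hα, abs_le.1 hβ⟩, hx⟩⟩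

lemma re_neg_of_quadratic {τ d : ℝ} (hτ : τ < 0) (hd : 0 < d) {μ : ℂ}
    (h : μ ^ 2 - τ * μ + d = 0) : μ.re < 0 := by
  have hre := congrArg Complex.re h
  have him := congrArg Complex.im h
  simp only [pow_two, Complex.add_re, Complex.sub_re, Complex.mul_re, Complex.ofReal_re,
    Complex.ofReal_im, Complex.zero_re, zero_mul, sub_zero] at hre
  simp only [pow_two, Complex.add_im, Complex.sub_im, Complex.mul_im, Complex.ofReal_re,
    Complex.ofReal_im, Complex.zero_im, zero_mul, add_zero] at him
  by_contra! hμ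
  rcases eq_or_ne μ.im 0 with h0 | h0
  · rw [h0] at hre
    nlinarith
  · have : μ.im * (2 * μ.re - τ) = 0 := by linarith
    rcases mul_eq_zero.1 this with h1 | h1
    · exact h0 h1
    · linarith

lemma hasFDerivAt_planarField (α β : ℝ) (x : EuclideanSpace ℝ (Fin 2)) :
    HasFDerivAt (planarField α β) (Matrix.toEuclideanCLM (n := Fin 2) (𝕜 := ℝ)
      !![cubicSlope α β (x 0) (x 0) - 1, 1; 1, -1]) x := by
  rw [← hasFDerivWithinAt_univ, hasFDerivWithinAt_euclidean, Fin.forall_fin_two]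
  simp only [hasFDerivWithinAt_univ]
  have hcoord : ∀ i : Fin 2, HasFDerivAt (fun y : EuclideanSpace ℝ (Fin 2) => y i)
      (EuclideanSpace.proj i : EuclideanSpace ℝ (Fin 2) →L[ℝ] ℝ) x :=
    fun i => (EuclideanSpace.proj (𝕜 := ℝ) i).hasFDerivAt
  constructor
  · have h := ((((hcoord 0).sub_const α).neg.mul (((hcoord 0).pow 2).sub_const (β + 1))).sub
      (hcoord 0)).add (hcoord 1)
    refine h.congr_fderiv ?_
    ext y
    simp [Matrix.mulVec, dotProduct, Fin.sum_univ_two, cubicSlope]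
    ring
  · refine ((hcoord 0).sub (hcoord 1)).congr_fderiv ?_
    ext y
    simp [Matrix.mulVec, dotProduct, Fin.sum_univ_two]
    ring

lemma isAttractingEquilibrium_F {a b : ℝ → ℝ} {l q : ℝ} (hzero : cubic (a l) (b l) q = 0)
    (hslope : cubicSlope (a l) (b l) q q < 0) : IsAttractingEquilibrium (F a b) l !₂[q, q] := by
  simp only [IsAttractingEquilibrium, F_eq_planarField]
  refine ⟨?_, _, hasFDerivAt_planarField _ _ _, fun μ hμ => ?_⟩
  · ext i
    fin_cases i <;> simp [hzero]
  · rw [Matrix.coe_toEuclideanCLM_eq_toEuclideanLin, Matrix.toEuclideanLin, Matrix.toLpLin_eq_toLin,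
      Matrix.charpoly_toLin, Matrix.charpoly_fin_two] at hμ
    simp only [Matrix.trace_fin_two_of, Matrix.det_fin_two_of] at hμ
    refine re_neg_of_quadratic (τ := cubicSlope (a l) (b l) q q - 1 + -1)
      (d := (cubicSlope (a l) (b l) q q - 1) * -1 - 1 * 1) (by linarith) (by linarith) ?_
    simpa [Polynomial.IsRoot] using hμ

end PlanarField

section Asymptotics

lemma eventually_lt_of_deriv_le_neg {w w' : ℝ → ℝ} {T δ ℓ m : ℝ} (hδ : 0 < δ) (hm : ℓ < m)
    (hw : ∀ t ∈ Ici T, HasDerivWithinAt w (w' t) (Ici T) t)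
    (hw' : ∀ᶠ t in atTop, ℓ ≤ w t → w' t ≤ -δ) : ∀ᶠ t in atTop, w t < m := by
  obtain ⟨S, hS, hTS⟩ :=
    ((eventually_forall_ge_atTop.2 hw').and (eventually_ge_atTop T)).exists
  -- The supersolution `ℓ + C exp (-μ (t - S))` decreases more slowly than `δ`.
  set C := max (w S - ℓ) 1
  have hC : 0 < C := one_pos.trans_le (le_max_right _ _)
  set μ := δ / (2 * C)
  have hμ : 0 < μ := by positivity
  have hμC : C * μ = δ / 2 := by simp only [μ]; field_simp
  set B : ℝ → ℝ := fun t => ℓ + C * Real.exp (-(μ * (t - S)))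
  have hB : ∀ t, HasDerivAt B (C * (Real.exp (-(μ * (t - S))) * -(μ * 1))) t := fun t =>
    ((((hasDerivAt_id t).sub_const S).const_mul μ).neg.exp.const_mul C).const_add ℓ
  have hle : ∀ t ≥ S, w t ≤ B t := fun t ht => by
    refine image_le_of_deriv_right_lt_deriv_boundary (a := S) (b := t)
      (fun s hs => ((hw s (hTS.trans hs.1)).mono fun r hr => hTS.trans hr.1).continuousWithinAt)
      (fun s hs => (hw s (hTS.trans hs.1)).mono fun r hr => hTS.trans (hs.1.trans hr)) ?_ hB
      (fun s hs hsB => ?_) (right_mem_Icc.2 ht)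
    · have : w S - ℓ ≤ C := le_max_left _ _
      simp only [B, sub_self, mul_zero, neg_zero, Real.exp_zero]
      linarith
    · have hexp : Real.exp (-(μ * (s - S))) ≤ 1 :=
        Real.exp_le_one_iff.2 (neg_nonpos.2 (mul_nonneg hμ.le (sub_nonneg.2 hs.1)))
      have hpos : 0 ≤ C * Real.exp (-(μ * (s - S))) := by positivity
      have hrate : C * μ * Real.exp (-(μ * (s - S))) ≤ C * μ * 1 := by gcongr
      linarith [hS s hs.1 (by simp only [hsB, B]; linarith)]
  have hlim : Tendsto B atTop (𝓝 (ℓ + C * 0)) :=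
    ((Real.tendsto_exp_neg_atTop_nhds_zero.comp ((tendsto_id.atTop_add tendsto_const_nhds
      (C := -S)).const_mul_atTop hμ)).const_mul C).const_add ℓ
  filter_upwards [hlim.eventually_lt_const (by simpa using hm), eventually_ge_atTop S] with t h ht
  exact (hle t ht).trans_lt h

variable {α β : ℝ → ℝ} {α₁ β₁ T q : ℝ} {x : ℝ → EuclideanSpace ℝ (Fin 2)}

lemma hasDerivWithinAt_apply {x : ℝ → EuclideanSpace ℝ (Fin 2)} {v : EuclideanSpace ℝ (Fin 2)}
    {s : Set ℝ} {t : ℝ} (h : HasDerivWithinAt x v s t) (i : Fin 2) :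
    HasDerivWithinAt (fun t => x t i) (v i) s t :=
  (EuclideanSpace.proj (𝕜 := ℝ) i).hasFDerivAt.comp_hasDerivWithinAt t h

lemma continuous_cubic : Continuous fun z : (ℝ × ℝ) × ℝ => cubic z.1.1 z.1.2 z.2 := by
  unfold cubic; fun_prop

lemma exists_eventually_cubic_lt (hα : Tendsto α atTop (𝓝 α₁)) (hβ : Tendsto β atTop (𝓝 β₁))
    (hq : cubic α₁ β₁ q < 0) :
    ∃ ε > 0, ∀ᶠ t in atTop, ∀ u, |u - q| ≤ 3 * ε → cubic (α t) (β t) u < -(5 * ε) := by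
  obtain ⟨d, hqd, hd⟩ := exists_between hq
  have hev := (continuous_cubic.tendsto ((α₁, β₁), q)).eventually_lt_const hqd
  rw [nhds_prod_eq, eventually_prod_iff] at hev
  obtain ⟨P, hP, Q, hQ, hPQ⟩ := hev
  obtain ⟨ρ, hρ, hball⟩ := Metric.nhds_basis_closedBall.mem_iff.1 hQ
  refine ⟨min (ρ / 3) (-d / 5), lt_min (by linarith) (by linarith), ?_⟩
  filter_upwards [(hα.prodMk_nhds hβ).eventually hP] with t ht u hu
  have hρ' := min_le_left (ρ / 3) (-d / 5)
  have hd' := min_le_right (ρ / 3) (-d / 5)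
  have hlt : cubic (α t) (β t) u < d := hPQ ht (hball (hu.trans (by linarith)))
  linarith

lemma exists_eventually_le_sub (hα : Tendsto α atTop (𝓝 α₁)) (hβ : Tendsto β atTop (𝓝 β₁))
    (hx : IsIntegralCurveOn x (fun t => planarField (α t) (β t)) (Ici T))
    (hq : cubic α₁ β₁ q < 0) :
    ∃ ε > 0, (∀ᶠ t in atTop, ∀ i, x t i ≤ q + ε) → ∀ᶠ t in atTop, ∀ i, x t i ≤ q - ε := by
  obtain ⟨ε, hε, hcubic⟩ := exists_eventually_cubic_lt hα hβ hq
  refine ⟨ε, hε, fun hle => ?_⟩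
  have hfirst : ∀ᶠ t in atTop, x t 0 < q - 2 * ε := by
    refine eventually_lt_of_deriv_le_neg hε (ℓ := q - 3 * ε) (by linarith)
      (fun t ht => hasDerivWithinAt_apply (hx t ht) 0) ?_
    filter_upwards [hcubic, hle] with t hc hle hge
    have := hc (x t 0) (abs_le.2 ⟨by linarith, by linarith [hle 0]⟩)
    rw [planarField_zero]
    linarith [hle 1]
  have hsecond : ∀ᶠ t in atTop, x t 1 < q - ε := by
    refine eventually_lt_of_deriv_le_neg (half_pos hε) (ℓ := q - 3 / 2 * ε) (by linarith)
      (fun t ht => hasDerivWithinAt_apply (hx t ht) 1) ?_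
    filter_upwards [hfirst] with t hlt hge
    rw [planarField_one]
    linarith
  filter_upwards [hfirst, hsecond] with t h₀ h₁
  exact Fin.forall_fin_two.2 ⟨by linarith, h₁.le⟩

lemma eventually_le_of_cubic_neg {q₀ q₁ : ℝ} (hα : Tendsto α atTop (𝓝 α₁))
    (hβ : Tendsto β atTop (𝓝 β₁))
    (hx : IsIntegralCurveOn x (fun t => planarField (α t) (β t)) (Ici T))
    (hneg : ∀ u, q₁ < u → u ≤ q₀ → cubic α₁ β₁ u < 0)
    (h₀ : ∀ᶠ t in atTop, ∀ i, x t i ≤ q₀) (hq : q₁ < q) :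
    ∀ᶠ t in atTop, ∀ i, x t i ≤ q := by
  set S : Set ℝ := {u | q₁ ≤ u ∧ ∀ᶠ t in atTop, ∀ i, x t i ≤ u}
  have hbdd : BddBelow S := ⟨q₁, fun u hu => hu.1⟩
  have hmono : ∀ {u w}, u ≤ w → (∀ᶠ t in atTop, ∀ i, x t i ≤ u) → ∀ᶠ t in atTop, ∀ i, x t i ≤ w :=
    fun huw hu => hu.mono fun t ht i => (ht i).trans huw
  rcases lt_or_ge q₀ q with hlt | hge
  · exact hmono hlt.le h₀
  have hne : q₀ ∈ S := ⟨hq.le.trans hge, h₀⟩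
  -- The infimum of the eventual upper bounds cannot lie where the cubic is negative.
  have hinf : sInf S ≤ q₁ := by
    by_contra! hlt
    obtain ⟨ε, hε, himp⟩ := exists_eventually_le_sub hα hβ hx
      (hneg _ hlt (csInf_le hbdd hne))
    obtain ⟨u, hu, hu'⟩ := exists_lt_of_csInf_lt ⟨_, hne⟩ (lt_add_of_pos_right (sInf S) hε)
    have hmem : max q₁ (sInf S - ε) ∈ S :=
      ⟨le_max_left _ _, hmono (le_max_right _ _) (himp (hmono hu'.le hu.2))⟩
    exact (csInf_le hbdd hmem).not_gt (max_lt hlt (by linarith))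
  obtain ⟨u, hu, huq⟩ := exists_lt_of_csInf_lt ⟨_, hne⟩ (hinf.trans_lt hq)
  exact hmono huq.le hu.2

end Asymptotics

section SignOfCubic

variable {α β u θ : ℝ}

lemma pow_three_le_mul {p q r : ℝ} (hθ : 0 ≤ θ) (hp : θ ≤ p) (hq : θ ≤ q) (hr : θ ≤ r) :
    θ ^ 3 ≤ p * q * r := by
  rw [pow_succ, pow_two]
  have hp' := hθ.trans hp
  have hq' := hθ.trans hq
  gcongr

lemma sq_sqrt_of_abs_lt (h : |α| < √(β + 1)) : √(β + 1) ^ 2 = β + 1 :=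
  Real.sq_sqrt (Real.sqrt_pos.1 ((abs_nonneg α).trans_lt h)).le

lemma cubic_eq_mul (h : |α| < √(β + 1)) (u : ℝ) :
    cubic α β u = -((α - u) * (√(β + 1) - u) * (u + √(β + 1))) := by
  unfold cubic
  linear_combination (α - u) * sq_sqrt_of_abs_lt h

lemma cubic_le_of_mem_Icc (h : |α| < √(β + 1)) (hθ : 0 ≤ θ)
    (hu : u ∈ Icc (-√(β + 1) + θ) (α - θ)) : cubic α β u ≤ -θ ^ 3 := by
  rw [cubic_eq_mul h, neg_le_neg_iff]
  exact pow_three_le_mul hθ (by linarith [hu.2]) (by linarith [hu.2, (abs_lt.1 h).2])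
    (by linarith [hu.1])

lemma cubic_neg_of_mem_Ioo (h : |α| < √(β + 1)) (hu : u ∈ Ioo (-√(β + 1)) α) :
    cubic α β u < 0 := by
  rw [cubic_eq_mul h, neg_lt_zero]
  exact mul_pos (mul_pos (sub_pos.2 hu.2) (by linarith [hu.2, (abs_lt.1 h).2]))
    (by linarith [hu.1])

lemma cubic_le_of_ge (h : |α| < √(β + 1)) (hθ : 0 ≤ θ) (hu : √(β + 1) + θ ≤ u) :
    cubic α β u ≤ -θ ^ 3 := by
  have hα := abs_lt.1 h
  rw [cubic_eq_mul h, neg_le_neg_iff, ← neg_mul_neg (α - u), neg_sub, neg_sub]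
  exact pow_three_le_mul hθ (by linarith) (by linarith) (by linarith)

lemma cubic_neg_of_gt (h : |α| < √(β + 1)) (hu : √(β + 1) < u) : cubic α β u < 0 :=
  (cubic_le_of_ge h (sub_pos.2 hu).le (add_sub_cancel _ _).le).trans_lt
    (neg_lt_zero.2 (pow_pos (sub_pos.2 hu) 3))

lemma planarField_neg (α β : ℝ) (x : EuclideanSpace ℝ (Fin 2)) :
    planarField (-α) β (-x) = -planarField α β x := by
  ext i
  fin_cases i
  · simp [cubic]; ring
  · simp; ring

end SignOfCubic

section ConvergenceToLowerEquilibrium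

lemma tendsto_of_tendsto_apply {ι : Type*} {l : Filter ι} {x : ι → EuclideanSpace ℝ (Fin 2)}
    {q : ℝ} (h : ∀ i, Tendsto (fun s => x s i) l (𝓝 q)) : Tendsto x l (𝓝 !₂[q, q]) := by
  rw [(PiLp.homeomorph 2 (fun _ : Fin 2 => ℝ)).isInducing.tendsto_nhds_iff, tendsto_pi_nhds,
    Fin.forall_fin_two]
  exact ⟨h 0, h 1⟩

lemma tendsto_of_eventually_le {α β : ℝ → ℝ} {α₁ β₁ T k M : ℝ}
    {x : ℝ → EuclideanSpace ℝ (Fin 2)} (h : |α₁| < √(β₁ + 1)) (hα : Tendsto α atTop (𝓝 α₁))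
    (hβ : Tendsto β atTop (𝓝 β₁))
    (hx : IsIntegralCurveOn x (fun t => planarField (α t) (β t)) (Ici T)) (hk : k < α₁)
    (hup : ∀ᶠ t in atTop, ∀ i, x t i ≤ k) (hlow : ∀ᶠ t in atTop, ∀ i, -M ≤ x t i) :
    Tendsto x atTop (𝓝 !₂[-√(β₁ + 1), -√(β₁ + 1)]) := by
  have hupper : ∀ q, -√(β₁ + 1) < q → ∀ᶠ t in atTop, ∀ i, x t i ≤ q := fun q hq =>
    eventually_le_of_cubic_neg hα hβ hx
      (fun u hu huk => cubic_neg_of_mem_Ioo h ⟨hu, huk.trans_lt hk⟩) hup hq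
  have hneg : IsIntegralCurveOn (-x) (fun t => planarField (-α t) (β t)) (Ici T) := fun t ht => by
    simpa only [Pi.neg_apply, planarField_neg] using (hx t ht).neg
  have hlower : ∀ q, √(β₁ + 1) < q → ∀ᶠ t in atTop, ∀ i, -x t i ≤ q := fun q hq =>
    eventually_le_of_cubic_neg hα.neg hβ hneg
      (fun u hu _ => cubic_neg_of_gt (by rwa [abs_neg]) hu)
      (hlow.mono fun t ht i => neg_le.1 (ht i)) hq
  refine tendsto_of_tendsto_apply fun i => tendsto_order.2 ⟨fun y hy => ?_, fun y hy => ?_⟩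
  · obtain ⟨q, hq, hqy⟩ := exists_between (lt_neg.1 hy)
    filter_upwards [hlower q hq] with t ht
    linarith [ht i]
  · obtain ⟨q, hq, hqy⟩ := exists_between hy
    filter_upwards [hupper q hq] with t ht
    exact (ht i).trans_lt hqy

end ConvergenceToLowerEquilibrium

section ParameterShift

variable {Λ f : ℝ → ℝ} {lm lp θ : ℝ}

lemma IsParameterShift.mem_Icc (hΛ : IsParameterShift Λ lm lp) (s : ℝ) : Λ s ∈ Icc lm lp :=
  Ioo_subset_Icc_self (hΛ.mem_Ioo s)

lemma IsParameterShift.le (hΛ : IsParameterShift Λ lm lp) : lm ≤ lp :=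
  (hΛ.mem_Icc 0).1.trans (hΛ.mem_Icc 0).2

lemma IsParameterShift.continuous_comp (hΛ : IsParameterShift Λ lm lp)
    (hf : ContinuousOn f (Icc lm lp)) : Continuous fun s => f (Λ s) :=
  hf.comp_continuous hΛ.contDiff.continuous hΛ.mem_Icc

lemma IsParameterShift.tendsto_comp_atBot (hΛ : IsParameterShift Λ lm lp)
    (hf : ContinuousOn f (Icc lm lp)) : Tendsto (fun s => f (Λ s)) atBot (𝓝 (f lm)) :=
  (hf lm (left_mem_Icc.2 hΛ.le)).tendsto.comp
    (tendsto_nhdsWithin_iff.2 ⟨hΛ.tendsto_atBot, Eventually.of_forall hΛ.mem_Icc⟩)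

lemma IsParameterShift.tendsto_comp_atTop (hΛ : IsParameterShift Λ lm lp)
    (hf : ContinuousOn f (Icc lm lp)) : Tendsto (fun s => f (Λ s)) atTop (𝓝 (f lp)) :=
  (hf lp (right_mem_Icc.2 hΛ.le)).tendsto.comp
    (tendsto_nhdsWithin_iff.2 ⟨hΛ.tendsto_atTop, Eventually.of_forall hΛ.mem_Icc⟩)

end ParameterShift

section PullbackAttractorOfShift

variable {α β : ℝ → ℝ} {A B : ℝ}

lemma exists_isIntegralCurveOn_planarField (hα : Continuous α) (hβ : Continuous β)
    (hA : ∀ t, |α t| ≤ A) (hB : ∀ t, |β t| ≤ B) (t₀ : ℝ) (x₀ : EuclideanSpace ℝ (Fin 2)) :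
    ∃ γ : ℝ → EuclideanSpace ℝ (Fin 2), γ t₀ = x₀ ∧
      IsIntegralCurveOn γ (fun t => planarField (α t) (β t)) (Ici t₀) := by
  obtain ⟨N, hN⟩ : ∃ N, N = ((A ^ 2 / 2 + B + 3) ^ 2 + A ^ 2 * (B + 1) ^ 2) / 2 := ⟨_, rfl⟩
  have hN0 : 0 ≤ N := hN ▸ by positivity
  obtain ⟨R, hR⟩ : ∃ R, R = ‖x₀‖ + 2 * N + 1 := ⟨_, rfl⟩
  have hR1 : 1 ≤ R := by linarith [norm_nonneg x₀]
  obtain ⟨K, hK⟩ := exists_lipschitzOnWith_planarField A B R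
  obtain ⟨L, hL⟩ := exists_norm_planarField_le A B R
  refine exists_isIntegralCurveOn_of_inward (by linarith) (fun t => hK _ _ (hA t) (hB t))
    (fun x => contDiff_planarField.continuous.comp ((hα.prodMk hβ).prodMk continuous_const))
    (fun t => hL _ _ (hA t) (hB t)) (fun t x hx => ?_) t₀ ?_
  · have hinner := inner_planarField_self_le (hA t) (hB t) x
    rw [hx, ← hN] at hinner
    nlinarith [norm_nonneg x₀]
  · rw [mem_closedBall_zero_iff]
    linarith

lemma tendsto_planarField {l : Filter ℝ} {α₀ β₀ : ℝ}
    (h : Tendsto (fun t => (α t, β t)) l (𝓝 (α₀, β₀))) (p : EuclideanSpace ℝ (Fin 2)) :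
    Tendsto (fun t => planarField (α t) (β t) p) l (𝓝 (planarField α₀ β₀ p)) := by
  have hcont : Continuous fun q : ℝ × ℝ => planarField q.1 q.2 p :=
    contDiff_planarField.continuous.comp (continuous_id.prodMk continuous_const)
  simpa only [Function.comp_def] using (hcont.tendsto (α₀, β₀)).comp h

lemma planarField_diag_eq_zero {α β q : ℝ} (h : cubic α β q = 0) :
    planarField α β !₂[q, q] = 0 := by
  ext i
  fin_cases i <;> simp [h]

lemma existsUnique_isIntegralCurve_planarField (hα : Continuous α) (hβ : Continuous β)
    (hA : ∀ t, |α t| ≤ A) (hB : ∀ t, |β t| ≤ B) {α₀ β₀ q : ℝ}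
    (hαβ : Tendsto (fun t => (α t, β t)) atBot (𝓝 (α₀, β₀)))
    (hzero : cubic α₀ β₀ q = 0) (hslope : cubicSlope α₀ β₀ q q < 0) :
    ∃! x, IsIntegralCurve x (fun t => planarField (α t) (β t)) ∧
      Tendsto x atBot (𝓝 !₂[q, q]) := by
  obtain ⟨κ, hκ, ρ, hρ, hcontr⟩ := eventually_contracting_planarField (p := !₂[q, q]) hslope
  have hforce : Tendsto (fun t => planarField (α t) (β t) !₂[q, q]) atBot (𝓝 0) := by
    rw [← planarField_diag_eq_zero hzero]
    exact tendsto_planarField hαβ _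
  have hsmall : ∀ᶠ t in atBot, ‖planarField (α t) (β t) !₂[q, q]‖ < κ * ρ :=
    (tendsto_zero_iff_norm_tendsto_zero.1 hforce).eventually_lt_const (mul_pos hκ hρ)
  obtain ⟨T, hT⟩ := eventually_atBot.1 ((hαβ.eventually hcontr).and hsmall)
  have hlip : ∀ t, OneSidedLipschitzOn (A ^ 2 + (B + 1)) (planarField (α t) (β t)) univ :=
    fun t => oneSidedLipschitzOn_planarField (hA t) (hB t)
  obtain ⟨x, hx, hlim⟩ := exists_tendsto_atBot hlip
    (exists_isIntegralCurveOn_planarField hα hβ hA hB) hκ hρ (fun t ht => (hT t ht).1)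
    (fun t ht => (hT t ht).2) hforce
  exact ⟨x, ⟨hx, hlim⟩, fun y hy => eq_of_tendsto_atBot hlip hκ hρ
    (fun t ht => (hT t ht).1) (fun t ht => (hT t ht).2) hy.1 hx hy.2 hlim⟩

variable {Λ a b : ℝ → ℝ} {lm lp r : ℝ}

lemma emanatesFrom_F_iff {p : EuclideanSpace ℝ (Fin 2)} {x : ℝ → EuclideanSpace ℝ (Fin 2)} :
    EmanatesFrom (F a b) Λ r p x ↔
      IsIntegralCurve x (fun t => planarField (a (Λ (r * t))) (b (Λ (r * t)))) ∧
        Tendsto x atBot (𝓝 p) := by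
  simp only [EmanatesFrom, F_eq_planarField, IsIntegralCurve]

lemma exists_isPullbackAttractor (hΛ : IsParameterShift Λ lm lp)
    (ha : ContinuousOn a (Icc lm lp)) (hb : ContinuousOn b (Icc lm lp)) (hr : 0 < r) {q : ℝ}
    (hzero : cubic (a lm) (b lm) q = 0) (hslope : cubicSlope (a lm) (b lm) q q < 0) :
    ∃ x, IsPullbackAttractor (F a b) Λ r !₂[q, q] x := by
  obtain ⟨A, hA⟩ := isCompact_Icc.exists_bound_of_continuousOn ha
  obtain ⟨B, hB⟩ := isCompact_Icc.exists_bound_of_continuousOn hb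
  have hrt : Tendsto (fun t => r * t) atBot atBot := tendsto_id.const_mul_atBot hr
  obtain ⟨x, hx, huniq⟩ := existsUnique_isIntegralCurve_planarField
    ((hΛ.continuous_comp ha).comp (continuous_const_mul r))
    ((hΛ.continuous_comp hb).comp (continuous_const_mul r))
    (fun _ => hA _ (hΛ.mem_Icc _)) (fun _ => hB _ (hΛ.mem_Icc _))
    (((hΛ.tendsto_comp_atBot ha).comp hrt).prodMk_nhds ((hΛ.tendsto_comp_atBot hb).comp hrt))
    hzero hslope
  exact ⟨x, emanatesFrom_F_iff.2 hx, fun y hy => huniq y (emanatesFrom_F_iff.1 hy)⟩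

end PullbackAttractorOfShift

section StablePaths

variable {Λ a b : ℝ → ℝ} {lm lp r : ℝ}

lemma cubic_sqrt {α β : ℝ} (h : |α| < √(β + 1)) : cubic α β √(β + 1) = 0 := by
  rw [cubic_eq_mul h]; ring

lemma cubicSlope_sqrt_neg {α β : ℝ} (h : |α| < √(β + 1)) :
    cubicSlope α β √(β + 1) √(β + 1) < 0 := by
  have hpos : 0 < √(β + 1) * (√(β + 1) - α) :=
    mul_pos ((abs_nonneg α).trans_lt h) (sub_pos.2 (abs_lt.1 h).2)
  have hfactor : cubicSlope α β √(β + 1) √(β + 1) = -2 * (√(β + 1) * (√(β + 1) - α)) := by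
    unfold cubicSlope
    linear_combination -sq_sqrt_of_abs_lt h
  linarith

lemma isStablePath_p₃ (hΛ : IsParameterShift Λ lm lp) (hb : ContinuousOn b (Icc lm lp))
    (hab : ∀ l ∈ Icc lm lp, |a l| < √(b l + 1)) :
    IsStablePath (F a b) Λ lm lp (fun s => p₃ b (Λ s)) (p₃ b lm) (p₃ b lp) := by
  have hc : ContinuousOn (fun l => √(b l + 1)) (Icc lm lp) := (hb.add continuousOn_const).sqrt
  have hatt : ∀ l ∈ Icc lm lp, IsAttractingEquilibrium (F a b) l (p₃ b l) := fun l hl =>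
    isAttractingEquilibrium_F (cubic_sqrt (hab l hl)) (cubicSlope_sqrt_neg (hab l hl))
  exact
    { continuous := continuous_iff_continuousAt.2 fun s =>
        tendsto_of_tendsto_apply fun i => by fin_cases i <;> exact (hΛ.continuous_comp hc).tendsto s
      attracting := fun s => hatt _ (hΛ.mem_Icc s)
      tendsto_atBot :=
        tendsto_of_tendsto_apply fun i => by fin_cases i <;> exact hΛ.tendsto_comp_atBot hc
      tendsto_atTop :=
        tendsto_of_tendsto_apply fun i => by fin_cases i <;> exact hΛ.tendsto_comp_atTop hc
      attracting_atBot := hatt _ (left_mem_Icc.2 hΛ.le)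
      attracting_atTop := hatt _ (right_mem_Icc.2 hΛ.le) }

lemma isStablePath_p₁ (hΛ : IsParameterShift Λ lm lp) (hb : ContinuousOn b (Icc lm lp))
    (hab : ∀ l ∈ Icc lm lp, |a l| < √(b l + 1)) :
    IsStablePath (F a b) Λ lm lp (fun s => p₁ b (Λ s)) (p₁ b lm) (p₁ b lp) := by
  have h := (isStablePath_p₃ (a := -a) hΛ hb (by simpa using hab)).reflect
  simpa only [reflect_F, neg_neg, neg_p₃] using h

lemma exists_isPullbackAttractor_p₃ (hΛ : IsParameterShift Λ lm lp)
    (ha : ContinuousOn a (Icc lm lp)) (hb : ContinuousOn b (Icc lm lp))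
    (hab : ∀ l ∈ Icc lm lp, |a l| < √(b l + 1)) (hr : 0 < r) :
    ∃ x, IsPullbackAttractor (F a b) Λ r (p₃ b lm) x :=
  have hlm := hab lm (left_mem_Icc.2 hΛ.le)
  exists_isPullbackAttractor hΛ ha hb hr (cubic_sqrt hlm) (cubicSlope_sqrt_neg hlm)

lemma exists_isPullbackAttractor_p₁ (hΛ : IsParameterShift Λ lm lp)
    (ha : ContinuousOn a (Icc lm lp)) (hb : ContinuousOn b (Icc lm lp))
    (hab : ∀ l ∈ Icc lm lp, |a l| < √(b l + 1)) (hr : 0 < r) :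
    ∃ x, IsPullbackAttractor (F a b) Λ r (p₁ b lm) x := by
  obtain ⟨x, hx⟩ := exists_isPullbackAttractor_p₃ (a := -a) hΛ ha.neg hb (by simpa using hab) hr
  exact ⟨-x, by simpa only [reflect_F, neg_neg, neg_p₃] using hx.reflect⟩

end StablePaths

lemma exists_monotone_between {ι R : Type*} [Preorder ι] [ConditionallyCompleteLattice R]
    {f g : ι → R} (h : ∀ s t, s ≤ t → f s ≤ g t) :
    ∃ k : ι → R, Monotone k ∧ ∀ t, f t ≤ k t ∧ k t ≤ g t := by
  have hbdd : ∀ t, g t ∈ upperBounds (f '' Iic t) := fun t => by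
    rintro _ ⟨s, hs, rfl⟩
    exact h s t hs
  have hmem : ∀ t, f t ∈ f '' Iic t := fun t => mem_image_of_mem f self_mem_Iic
  exact ⟨fun t => sSup (f '' Iic t),
    fun s t hst => csSup_le_csSup ⟨_, hbdd t⟩ ⟨_, hmem s⟩ (image_mono (Iic_subset_Iic.2 hst)),
    fun t => ⟨le_csSup ⟨_, hbdd t⟩ (hmem t), csSup_le ⟨_, hmem t⟩ (hbdd t)⟩⟩

lemma exists_dist_le_add_mul {X Y : Type*} [PseudoMetricSpace X] [PseudoMetricSpace Y]
    {f : X → Y} {s : Set X} (hs : IsCompact s) (hf : ContinuousOn f s) {θ : ℝ} (hθ : 0 < θ) :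
    ∃ K, 0 ≤ K ∧ ∀ x ∈ s, ∀ y ∈ s, dist (f x) (f y) ≤ θ + K * dist x y := by
  obtain ⟨δ, hδ, hclose⟩ := Metric.uniformContinuousOn_iff_le.1
    (hs.uniformContinuousOn_of_continuous hf) θ hθ
  have hdiam : 0 ≤ Metric.diam (f '' s) := Metric.diam_nonneg
  refine ⟨Metric.diam (f '' s) / δ, by positivity, fun x hx y hy => ?_⟩
  rcases le_total (dist x y) δ with hxy | hxy
  · exact (hclose x hx y hy hxy).trans (le_add_of_nonneg_right (by positivity))
  · calc dist (f x) (f y) ≤ Metric.diam (f '' s) :=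
          Metric.dist_le_diam_of_mem (hs.image_of_continuousOn hf).isBounded
            (mem_image_of_mem f hx) (mem_image_of_mem f hy)
      _ = Metric.diam (f '' s) / δ * δ := (div_mul_cancel₀ _ hδ.ne').symm
      _ ≤ Metric.diam (f '' s) / δ * dist x y := by gcongr
      _ ≤ θ + Metric.diam (f '' s) / δ * dist x y := le_add_of_nonneg_left hθ.le

section ParameterShift

variable {Λ f a c : ℝ → ℝ} {lm lp θ : ℝ}

lemma IsParameterShift.exists_lipschitzWith (hΛ : IsParameterShift Λ lm lp) :
    ∃ C, LipschitzWith C Λ := by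
  let Λ' : ZeroAtInftyContinuousMap ℝ ℝ :=
    ⟨⟨deriv Λ, hΛ.contDiff.continuous_deriv one_le_two⟩, by
      rw [cocompact_eq_atBot_atTop]
      exact hΛ.deriv_atBot.sup hΛ.deriv_atTop⟩
  exact ⟨_, lipschitzWith_of_nnnorm_deriv_le (hΛ.contDiff.differentiable two_ne_zero)
    Λ'.toBCF.nnnorm_coe_le_nnnorm⟩

lemma IsParameterShift.exists_abs_comp_sub_le (hΛ : IsParameterShift Λ lm lp)
    (hf : ContinuousOn f (Icc lm lp)) (hθ : 0 < θ) :
    ∃ L, ∀ s t, |f (Λ s) - f (Λ t)| ≤ θ + L * |s - t| := by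
  obtain ⟨K, hK, hfK⟩ := exists_dist_le_add_mul isCompact_Icc hf hθ
  obtain ⟨C, hC⟩ := hΛ.exists_lipschitzWith
  refine ⟨K * C, fun s t => (hfK _ (hΛ.mem_Icc s) _ (hΛ.mem_Icc t)).trans ?_⟩
  rw [mul_assoc]
  gcongr
  exact hC.dist_le_mul s t

/-- The extension of `Λ` to `[-∞, ∞]` by its limits. -/
def extendShift (Λ : ℝ → ℝ) (lm lp : ℝ) : EReal → ℝ
  | ⊥ => lm
  | ⊤ => lp
  | (s : ℝ) => Λ s

lemma IsParameterShift.continuous_extendShift (hΛ : IsParameterShift Λ lm lp) :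
    Continuous (extendShift Λ lm lp) := by
  refine continuous_iff_continuousAt.2 fun s => ?_
  induction s with
  | bot =>
    rw [continuousAt_iff_punctured_nhds, EReal.nhdsWithin_bot, tendsto_map'_iff]
    exact hΛ.tendsto_atBot
  | top =>
    rw [continuousAt_iff_punctured_nhds, EReal.nhdsWithin_top, tendsto_map'_iff]
    exact hΛ.tendsto_atTop
  | coe s =>
    rw [ContinuousAt, EReal.nhds_coe, tendsto_map'_iff]
    exact hΛ.contDiff.continuous.tendsto s

lemma IsParameterShift.extendShift_mem_Icc (hΛ : IsParameterShift Λ lm lp) (s : EReal) :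
    extendShift Λ lm lp s ∈ Icc lm lp := by
  induction s with
  | bot => exact left_mem_Icc.2 hΛ.le
  | top => exact right_mem_Icc.2 hΛ.le
  | coe s => exact hΛ.mem_Icc s

lemma IsParameterShift.exists_gap (hΛ : IsParameterShift Λ lm lp)
    (ha : ContinuousOn a (Icc lm lp)) (hc : ContinuousOn c (Icc lm lp))
    (hdiag : ∀ l ∈ Icc lm lp, 0 < a l + c l)
    (h : ∀ s₁ s₂, s₁ < s₂ → 0 < a (Λ s₂) + c (Λ s₁)) (hbot : ∀ s₂, 0 < a (Λ s₂) + c lm)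
    (htop : ∀ s₁, 0 < a lp + c (Λ s₁)) (hbt : 0 < a lp + c lm) :
    ∃ η > 0, ∀ s₁ s₂, s₁ ≤ s₂ → η ≤ a (Λ s₂) + c (Λ s₁) := by
  have hcont : Continuous fun s : EReal × EReal =>
      a (extendShift Λ lm lp s.2) + c (extendShift Λ lm lp s.1) :=
    ((ha.comp_continuous hΛ.continuous_extendShift hΛ.extendShift_mem_Icc).comp
      continuous_snd).add
    ((hc.comp_continuous hΛ.continuous_extendShift hΛ.extendShift_mem_Icc).comp continuous_fst)
  obtain ⟨⟨x, y⟩, hxy, hmin⟩ := OrderClosedTopology.isClosed_le'.isCompact.exists_isMinOn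
    ⟨((0 : EReal), 0), le_rfl⟩ hcont.continuousOn
  refine ⟨a (extendShift Λ lm lp y) + c (extendShift Λ lm lp x), ?_, fun s₁ s₂ hs =>
    hmin (show ((s₁ : EReal), (s₂ : EReal)) ∈ _ from EReal.coe_le_coe_iff.2 hs)⟩
  rcases (show x ≤ y from hxy).eq_or_lt with rfl | hlt
  · exact hdiag _ (hΛ.extendShift_mem_Icc _)
  · induction x with
    | top => exact absurd hlt not_top_lt
    | bot =>
      induction y with
      | bot => exact absurd hlt (lt_irrefl _)
      | top => exact hbt
      | coe y => exact hbot y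
    | coe x =>
      induction y with
      | bot => exact absurd hlt not_lt_bot
      | top => exact htop x
      | coe y => exact h x y (EReal.coe_lt_coe_iff.1 hlt)

end ParameterShift

section Quadrant

variable {α β q e : ℝ} {x v : EuclideanSpace ℝ (Fin 2)}

/-- The closed quadrant to the lower left of the point `(q, q + e)`. -/
def quadrant (q e : ℝ) : Set (EuclideanSpace ℝ (Fin 2)) :=
  {x | x 0 ≤ q} ∩ {x | x 1 ≤ q + e}

lemma mem_quadrant : x ∈ quadrant q e ↔ x 0 ≤ q ∧ x 1 ≤ q + e := Iff.rfl

lemma isClosed_quadrant (q e : ℝ) : IsClosed (quadrant q e) :=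
  (isClosed_le (by fun_prop) continuous_const).inter (isClosed_le (by fun_prop) continuous_const)

lemma quadrant_mono {q' : ℝ} (h : q ≤ q') : quadrant q e ⊆ quadrant q' e := fun _ hx =>
  mem_quadrant.2 ⟨(mem_quadrant.1 hx).1.trans h, (mem_quadrant.1 hx).2.trans (by gcongr)⟩

lemma mem_interior_quadrant (h0 : x 0 < q) (h1 : x 1 < q + e) : x ∈ interior (quadrant q e) :=
  mem_interior.2 ⟨{y | y 0 < q} ∩ {y | y 1 < q + e},
    fun _ hy => mem_quadrant.2 ⟨le_of_lt hy.1, le_of_lt hy.2⟩,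
    (isOpen_lt (by fun_prop) continuous_const).inter (isOpen_lt (by fun_prop) continuous_const),
    h0, h1⟩

lemma pointsStrictlyInto_quadrant (hx : x ∈ quadrant q e) (h0 : x 0 = q → v 0 < 0)
    (h1 : x 1 = q + e → v 1 < 0) : PointsStrictlyInto (quadrant q e) x v :=
  let π (i : Fin 2) : EuclideanSpace ℝ (Fin 2) →L[ℝ] ℝ := EuclideanSpace.proj i
  (pointsStrictlyInto_sublevel (π 0).hasFDerivAt hx.1 h0).inter
    (pointsStrictlyInto_sublevel (π 1).hasFDerivAt hx.2 h1)

lemma planarField_pointsStrictlyInto_quadrant (he : 0 < e) (hq : cubic α β q + e < 0)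
    (hx : x ∈ quadrant q e) : PointsStrictlyInto (quadrant q e) x (planarField α β x) := by
  obtain ⟨hx0, hx1⟩ := mem_quadrant.1 hx
  refine pointsStrictlyInto_quadrant hx (fun h => ?_) fun h => ?_
  · rw [planarField_zero, h]
    linarith
  · rw [planarField_one, h]
    linarith

end Quadrant

section Trap

variable {α β M q e : ℝ} {x : EuclideanSpace ℝ (Fin 2)}

/-- The box `[-M, q] × [-(M + 1), q + e]`; at its corners the second component of the field still
points inwards because the two sides exceed `q` and `-M` by `e` and `1`. -/
def trap (M q e : ℝ) : Set (EuclideanSpace ℝ (Fin 2)) :=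
  quadrant q e ∩ Neg.neg ⁻¹' quadrant M 1

lemma isClosed_trap (M q e : ℝ) : IsClosed (trap M q e) :=
  (isClosed_quadrant q e).inter ((isClosed_quadrant M 1).preimage continuous_neg)

lemma trap_mono {q' : ℝ} (h : q ≤ q') : trap M q e ⊆ trap M q' e :=
  inter_subset_inter_left _ (quadrant_mono h)

lemma apply_le_of_mem_trap (he : 0 < e) (hx : x ∈ trap M q e) (i : Fin 2) : x i ≤ q + e := by
  obtain ⟨h0, h1⟩ := mem_quadrant.1 hx.1
  fin_cases i
  · exact h0.trans (le_add_of_nonneg_right he.le)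
  · exact h1

lemma neg_le_apply_of_mem_trap (hx : x ∈ trap M q e) (i : Fin 2) : -(M + 1) ≤ x i := by
  obtain ⟨h0, h1⟩ := mem_quadrant.1 hx.2
  rw [PiLp.neg_apply] at h0 h1
  fin_cases i
  · exact neg_le.1 (h0.trans (le_add_of_nonneg_right zero_le_one))
  · exact neg_le.1 h1

lemma isCompact_trap (he : 0 < e) : IsCompact (trap M q e) :=
  ((PiLp.homeomorph 2 fun _ : Fin 2 => ℝ).isCompact_preimage.2
    (isCompact_Icc (a := fun _ => -(M + 1)) (b := fun _ => q + e))).of_isClosed_subset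
    (isClosed_trap M q e)
    fun _ hx => ⟨neg_le_apply_of_mem_trap hx, apply_le_of_mem_trap he hx⟩

lemma mem_interior_trap {c : ℝ} (hq : -c < q) (hM : c < M) (he : 0 < e) :
    !₂[-c, -c] ∈ interior (trap M q e) := by
  rw [trap, interior_inter]
  refine ⟨mem_interior_quadrant hq (by simpa using hq.trans (lt_add_of_pos_right q he)),
    preimage_interior_subset_interior_preimage continuous_neg
      (mem_interior_quadrant (by simpa using hM) ?_)⟩
  simpa using hM.trans (lt_add_one M)

lemma planarField_pointsStrictlyInto_trap (he : 0 < e) (hq : cubic α β q + e < 0)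
    (hM : cubic (-α) β M + 1 < 0) (hx : x ∈ trap M q e) :
    PointsStrictlyInto (trap M q e) x (planarField α β x) := by
  refine (planarField_pointsStrictlyInto_quadrant he hq hx.1).inter ?_
  have h := (planarField_pointsStrictlyInto_quadrant one_pos hM hx.2).reflect
  rwa [planarField_neg, neg_neg] at h

lemma tendsto_of_mem_trap {α β k : ℝ → ℝ} {α₁ β₁ q T : ℝ} {x : ℝ → EuclideanSpace ℝ (Fin 2)}
    (h : |α₁| < √(β₁ + 1)) (hα : Tendsto α atTop (𝓝 α₁)) (hβ : Tendsto β atTop (𝓝 β₁))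
    (hx : IsIntegralCurveOn x (fun t => planarField (α t) (β t)) (Ici T)) (hmono : Monotone k)
    (he : 0 < e) (hk : ∀ t, cubic (α t) (β t) (k t) + e < 0)
    (hM : ∀ t, cubic (-α t) (β t) M + 1 < 0) (hkq : ∀ t, k t ≤ q) (hq : q + e < α₁)
    (hT : x T ∈ trap M (k T) e) : Tendsto x atTop (𝓝 !₂[-√(β₁ + 1), -√(β₁ + 1)]) := by
  have hmem : ∀ t ≥ T, x t ∈ trap M (k t) e := fun t ht =>
    mem_of_pointsStrictlyInto (fun _ _ hst => trap_mono (hmono hst))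
      (fun _ => isClosed_trap _ _ _) (hx.mono Icc_subset_Ici_self)
      (fun s _ hs => planarField_pointsStrictlyInto_trap he (hk s) (hM s)
        ((isClosed_trap _ _ _).frontier_subset hs)) hT t ⟨ht, le_rfl⟩
  refine tendsto_of_eventually_le h hα hβ hx hq ?_ ?_ (M := M + 1)
  · filter_upwards [eventually_ge_atTop T] with t ht
    exact apply_le_of_mem_trap he (trap_mono (hkq t) (hmem t ht))
  · filter_upwards [eventually_ge_atTop T] with t ht
    exact neg_le_apply_of_mem_trap (hmem t ht)

end Trap

section Separating

variable {Λ a b k : ℝ → ℝ} {lm lp θ M : ℝ}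

/-- A nondecreasing function `k` which stays, with a margin `θ`, between the first coordinates
`-√(b + 1)` of the lower equilibrium and `a` of the saddle along the parameter shift. -/
structure IsSeparating (Λ a b : ℝ → ℝ) (θ : ℝ) (k : ℝ → ℝ) : Prop where
  pos : 0 < θ
  le_one : θ ≤ 1
  mono : Monotone k
  lower : ∀ s, -√(b (Λ s) + 1) + θ ≤ k s
  upper : ∀ s, k s ≤ a (Λ s) - θ

lemma exists_isSeparating {η : ℝ} (hη : 0 < η)
    (h : ∀ s t, s ≤ t → η ≤ a (Λ t) + √(b (Λ s) + 1)) :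
    ∃ θ k, IsSeparating Λ a b θ k := by
  have hle : ∀ s t, s ≤ t →
      -√(b (Λ s) + 1) + min (η / 2) 1 ≤ a (Λ t) - min (η / 2) 1 := fun s t hst => by
    linarith [h s t hst, min_le_left (η / 2) 1]
  obtain ⟨k, hk, hbounds⟩ := exists_monotone_between hle
  exact ⟨_, k, lt_min (half_pos hη) one_pos, min_le_right _ _, hk, fun s => (hbounds s).1,
    fun s => (hbounds s).2⟩

lemma exists_sqrt_add_two_le (hb : ContinuousOn b (Icc lm lp)) :
    ∃ M, ∀ l ∈ Icc lm lp, √(b l + 1) + 2 ≤ M := by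
  have hc : ContinuousOn (fun l => √(b l + 1)) (Icc lm lp) := (hb.add continuousOn_const).sqrt
  obtain ⟨C, hC⟩ := isCompact_Icc.exists_bound_of_continuousOn hc
  exact ⟨C + 2, fun l hl => by linarith [(le_abs_self _).trans (hC l hl)]⟩

lemma cubic_neg_add_one_lt {α β : ℝ} (h : |α| < √(β + 1)) (hM : √(β + 1) + 2 ≤ M) :
    cubic (-α) β M + 1 < 0 := by
  linarith [cubic_le_of_ge (α := -α) (by rwa [abs_neg]) zero_le_two hM]

namespace IsSeparating

lemma lower_atBot (hk : IsSeparating Λ a b θ k) (hΛ : IsParameterShift Λ lm lp)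
    (hb : ContinuousOn b (Icc lm lp)) (s : ℝ) : -√(b lm + 1) + θ ≤ k s := by
  refine le_of_tendsto ((hΛ.tendsto_comp_atBot (hb.add continuousOn_const).sqrt).neg.add_const θ) ?_
  filter_upwards [eventually_le_atBot s] with t ht using (hk.lower t).trans (hk.mono ht)

lemma upper_atTop (hk : IsSeparating Λ a b θ k) (hΛ : IsParameterShift Λ lm lp)
    (ha : ContinuousOn a (Icc lm lp)) (s : ℝ) : k s ≤ a lp - θ := by
  refine ge_of_tendsto ((hΛ.tendsto_comp_atTop ha).sub_const θ) ?_
  filter_upwards [eventually_ge_atTop s] with t ht using (hk.mono ht).trans (hk.upper t)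

lemma gap_atTop (hk : IsSeparating Λ a b θ k) (hΛ : IsParameterShift Λ lm lp)
    (ha : ContinuousOn a (Icc lm lp)) (hb : ContinuousOn b (Icc lm lp)) :
    -√(b lp + 1) + θ ≤ a lp - θ :=
  le_of_tendsto ((hΛ.tendsto_comp_atTop (hb.add continuousOn_const).sqrt).neg.add_const θ)
    (Eventually.of_forall fun s => (hk.lower s).trans (hk.upper_atTop hΛ ha s))

lemma offset_pos (hk : IsSeparating Λ a b θ k) : 0 < θ ^ 3 / 2 := half_pos (pow_pos hk.pos 3)

lemma cubic_add_lt (hk : IsSeparating Λ a b θ k) {s : ℝ}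
    (h : |a (Λ s)| < √(b (Λ s) + 1)) : cubic (a (Λ s)) (b (Λ s)) (k s) + θ ^ 3 / 2 < 0 := by
  linarith [cubic_le_of_mem_Icc h hk.pos.le ⟨hk.lower s, hk.upper s⟩, hk.offset_pos]

lemma sub_add_lt (hk : IsSeparating Λ a b θ k) (u : ℝ) : u - θ + θ ^ 3 / 2 < u := by
  linarith [hk.pos, pow_le_of_le_one hk.pos.le hk.le_one three_ne_zero]

lemma trap_subset_basin (hk : IsSeparating Λ a b θ k) (h : |a lp| < √(b lp + 1))
    (hgap : -√(b lp + 1) + θ ≤ a lp - θ) (hM : √(b lp + 1) + 2 ≤ M) :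
    trap M (a lp - θ) (θ ^ 3 / 2) ⊆ basin (F a b) lp (p₁ b lp) := by
  intro x₀ hx₀
  obtain ⟨γ, rfl, hγ⟩ := exists_isIntegralCurveOn_planarField (α := fun _ => a lp)
    (β := fun _ => b lp) continuous_const continuous_const (fun _ => le_rfl) (fun _ => le_rfl)
    0 x₀
  have hcubic : cubic (a lp) (b lp) (a lp - θ) + θ ^ 3 / 2 < 0 := by
    linarith [cubic_le_of_mem_Icc h hk.pos.le ⟨hgap, le_rfl⟩, hk.offset_pos]
  refine ⟨γ, rfl, fun t ht => ?_, tendsto_of_mem_trap h tendsto_const_nhds tendsto_const_nhds hγ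
    monotone_const hk.offset_pos (fun _ => hcubic) (fun _ => cubic_neg_add_one_lt h hM)
    (fun _ => le_rfl) (hk.sub_add_lt _) hx₀⟩
  rw [F_eq_planarField]
  exact hγ t ht

lemma isForwardInflowingStable (hk : IsSeparating Λ a b θ k) (hΛ : IsParameterShift Λ lm lp)
    (ha : ContinuousOn a (Icc lm lp)) (hb : ContinuousOn b (Icc lm lp))
    (hab : ∀ l ∈ Icc lm lp, |a l| < √(b l + 1)) :
    IsForwardInflowingStable (F a b) Λ lm lp (fun s => p₁ b (Λ s)) (p₁ b lm) (p₁ b lp) := by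
  obtain ⟨M, hM⟩ := exists_sqrt_add_two_le hb
  have hlp := right_mem_Icc.2 hΛ.le
  have hθ := hk.pos
  have hint : ∀ l ∈ Icc lm lp, ∀ q, -√(b l + 1) < q →
      p₁ b l ∈ interior (trap M q (θ ^ 3 / 2)) := fun l hl q hq =>
    mem_interior_trap hq (by linarith [hM l hl]) hk.offset_pos
  have hclosure : closure (⋃ s, trap M (k s) (θ ^ 3 / 2)) ⊆ trap M (a lp - θ) (θ ^ 3 / 2) :=
    closure_minimal (iUnion_subset fun s => trap_mono (hk.upper_atTop hΛ ha s))
      (isClosed_trap _ _ _)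
  obtain ⟨s, hs⟩ : ∃ s, -√(b lp + 1) < -√(b (Λ s) + 1) + θ :=
    (((hΛ.tendsto_comp_atTop (hb.add continuousOn_const).sqrt).neg.add_const θ).eventually_const_lt
      (lt_add_of_pos_right _ hθ)).exists
  refine ⟨isStablePath_p₁ hΛ hb hab, fun s => trap M (k s) (θ ^ 3 / 2),
    fun s => isCompact_trap hk.offset_pos,
    fun s => hint _ (hΛ.mem_Icc s) _ (by linarith [hk.lower s]),
    fun s₁ s₂ hs => trap_mono (hk.mono hs.le), fun s x hx => ?_,
    interior_mono (subset_iInter fun s => trap_mono (hk.lower_atBot hΛ hb s))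
      (hint lm (left_mem_Icc.2 hΛ.le) _ (lt_add_of_pos_right _ hθ)),
    interior_mono ((subset_iUnion (fun s => trap M (k s) (θ ^ 3 / 2)) s).trans subset_closure)
      (hint lp hlp (k s) (hs.trans_le (hk.lower s))),
    (isCompact_trap hk.offset_pos).of_isClosed_subset isClosed_closure hclosure,
    hclosure.trans (hk.trap_subset_basin (hab lp hlp) (hk.gap_atTop hΛ ha hb) (hM lp hlp))⟩
  have hl := hab _ (hΛ.mem_Icc s)
  rw [F_eq_planarField]
  exact planarField_pointsStrictlyInto_trap hk.offset_pos (hk.cubic_add_lt hl)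
    (cubic_neg_add_one_lt hl (hM _ (hΛ.mem_Icc s))) ((isClosed_trap _ _ _).frontier_subset hx)

lemma noRTipping (hk : IsSeparating Λ a b θ k) (hΛ : IsParameterShift Λ lm lp)
    (ha : ContinuousOn a (Icc lm lp)) (hb : ContinuousOn b (Icc lm lp))
    (hab : ∀ l ∈ Icc lm lp, |a l| < √(b l + 1)) :
    NoRTipping (F a b) Λ (p₁ b lm) (p₁ b lp) := by
  intro r hr
  obtain ⟨M, hM⟩ := exists_sqrt_add_two_le hb
  obtain ⟨x, hx⟩ := exists_isPullbackAttractor_p₁ hΛ ha hb hab hr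
  obtain ⟨hcurve, hlim⟩ := emanatesFrom_F_iff.1 hx.1
  have hstart : p₁ b lm ∈ interior (trap M (-√(b lm + 1) + θ) (θ ^ 3 / 2)) :=
    mem_interior_trap (lt_add_of_pos_right _ hk.pos)
      (by linarith [hM lm (left_mem_Icc.2 hΛ.le)]) hk.offset_pos
  obtain ⟨T, hT⟩ := (hlim.eventually (mem_interior_iff_mem_nhds.1 hstart)).exists
  have hrt : Tendsto (fun t => r * t) atTop atTop := tendsto_id.const_mul_atTop hr
  have hl := fun t => hab _ (hΛ.mem_Icc (r * t))
  exact ⟨x, hx, tendsto_of_mem_trap (hab lp (right_mem_Icc.2 hΛ.le))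
    ((hΛ.tendsto_comp_atTop ha).comp hrt) ((hΛ.tendsto_comp_atTop hb).comp hrt)
    (hcurve.isIntegralCurveOn (Ici T)) (hk.mono.comp (monotone_id.const_mul hr.le))
    hk.offset_pos (fun t => hk.cubic_add_lt (hl t))
    (fun t => cubic_neg_add_one_lt (hl t) (hM _ (hΛ.mem_Icc _)))
    (fun t => hk.upper_atTop hΛ ha _) (hk.sub_add_lt _)
    (trap_mono (hk.lower_atBot hΛ hb _) hT)⟩

end IsSeparating

end Separating

section Barriers

variable {α β k : ℝ → ℝ} {x : ℝ → EuclideanSpace ℝ (Fin 2)} {T θ e : ℝ}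

lemma mem_quadrant_of_barrier {κ t₀ t₁ : ℝ} (hκ : κ < e)
    (hx : IsIntegralCurve x fun t => planarField (α t) (β t))
    (hmono : Monotone fun t => k t + κ * t)
    (hcubic : ∀ t ∈ Ico t₀ t₁, cubic (α t) (β t) (k t) + e + κ < 0)
    (h₀ : x t₀ ∈ quadrant (k t₀) e) : ∀ t ∈ Icc t₀ t₁, x t ∈ quadrant (k t) e := by
  -- In the frame drifting along `-κ (1, 1)` the quadrants below the barrier only grow.
  let d : EuclideanSpace ℝ (Fin 2) := !₂[1, 1]
  let γ : ℝ → EuclideanSpace ℝ (Fin 2) := fun t => x t + (κ * t) • d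
  have hmem : ∀ t, γ t ∈ quadrant (k t + κ * t) e ↔ x t ∈ quadrant (k t) e := fun t => by
    simp [γ, d, mem_quadrant, add_right_comm]
  have hγ : ∀ t, HasDerivAt γ (planarField (α t) (β t) (x t) + κ • d) t := fun t =>
    (hx t).add (by simpa using ((hasDerivAt_id t).const_mul κ).smul_const d)
  intro t ht
  refine (hmem t).1 (mem_of_pointsStrictlyInto (K := fun t => quadrant (k t + κ * t) e)
    (fun s t hst => quadrant_mono (hmono hst)) (fun _ => isClosed_quadrant _ _)
    (fun t _ => (hγ t).hasDerivWithinAt) (fun t ht hfr => ?_) ((hmem t₀).2 h₀) t ht)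
  have hγt := (isClosed_quadrant _ _).frontier_subset hfr
  obtain ⟨h0, h1⟩ := mem_quadrant.1 ((hmem t).1 hγt)
  refine pointsStrictlyInto_quadrant hγt (fun h => ?_) fun h => ?_
  · have hx0 : x t 0 = k t := by simpa [γ, d] using h
    have := hcubic t ht
    simp only [d, PiLp.add_apply, PiLp.smul_apply, planarField_zero, hx0, smul_eq_mul, mul_one,
      Matrix.cons_val_zero]
    linarith
  · have hx1 : x t 1 = k t + e := by simpa [γ, d, add_right_comm] using h
    simp only [d, PiLp.add_apply, PiLp.smul_apply, planarField_one, hx1, smul_eq_mul, mul_one,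
      Matrix.cons_val_one, Matrix.cons_val_fin_one]
    linarith

lemma mem_quadrant_of_tendsto_atBot {β₀ : ℝ} (h : ∀ t, |α t| < √(β t + 1))
    (hx : IsIntegralCurve x fun t => planarField (α t) (β t)) (hβ : Tendsto β atBot (𝓝 β₀))
    (hlim : Tendsto x atBot (𝓝 !₂[√(β₀ + 1), √(β₀ + 1)])) (hθ : 0 < θ)
    (hmono : Monotone fun t => k t + θ ^ 3 / 4 * t) (hk : ∀ t ≤ T, √(β t + 1) + θ ≤ k t) :
    x T ∈ quadrant (k T) (θ ^ 3 / 2) := by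
  have hθ3 : 0 < θ ^ 3 := pow_pos hθ 3
  have hstart : ∀ i, ∀ᶠ t in atBot, x t i < √(β t + 1) + θ := fun i => by
    have hxi : Tendsto (fun t => x t i) atBot (𝓝 √(β₀ + 1)) := by
      have := ((EuclideanSpace.proj (𝕜 := ℝ) i).continuous.tendsto _).comp hlim
      fin_cases i <;> exact this
    exact hxi.eventually_lt (((hβ.add_const 1).sqrt).add_const θ) (lt_add_of_pos_right _ hθ)
  obtain ⟨t₀, ht₀, h0, h1⟩ :=
    ((eventually_le_atBot T).and ((hstart 0).and (hstart 1))).exists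
  have hk₀ := hk t₀ ht₀
  refine mem_quadrant_of_barrier (κ := θ ^ 3 / 4) (by linarith) hx hmono (fun t ht => ?_)
    (mem_quadrant.2 ⟨by linarith, by linarith⟩) T ⟨ht₀, le_rfl⟩
  linarith [cubic_le_of_ge (h t) hθ.le (hk t ht.2.le)]

lemma mem_quadrant_of_mem_Icc {q C τ : ℝ} (he : 0 < e) (hC : 0 ≤ C) (hτ : 0 ≤ τ)
    (hx : IsIntegralCurve x fun t => planarField (α t) (β t))
    (hcubic : ∀ t, ∀ u ∈ Icc q (q + C * τ), cubic (α t) (β t) u + e < C)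
    (h₀ : x 0 ∈ quadrant q e) : x τ ∈ quadrant (q + C * τ) e := by
  refine mem_quadrant_of_barrier (k := fun t => q + C * t) (κ := -C) (t₀ := 0) (by linarith) hx
    (by simpa using monotone_const) (fun t ht => ?_) (by simpa using h₀) τ ⟨hτ, le_rfl⟩
  have hu : q + C * t ∈ Icc q (q + C * τ) :=
    ⟨le_add_of_nonneg_right (mul_nonneg hC ht.1),
      add_le_add_right (mul_le_mul_of_nonneg_left ht.2.le hC) q⟩
  linarith [hcubic t _ hu]

lemma mem_quadrant_of_mem_quadrant (h : ∀ t, |α t| < √(β t + 1)) (hθ : 0 < θ)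
    (hx : IsIntegralCurve x fun t => planarField (α t) (β t))
    (hmono : Monotone fun t => k t + θ ^ 3 / 4 * t)
    (hk : ∀ t ≥ T, k t ∈ Icc (-√(β t + 1) + θ) (α t - θ))
    (hT : x T ∈ quadrant (k T) (θ ^ 3 / 2)) : ∀ t ≥ T, x t ∈ quadrant (k t) (θ ^ 3 / 2) := by
  have hθ3 : 0 < θ ^ 3 := pow_pos hθ 3
  intro t ht
  refine mem_quadrant_of_barrier (κ := θ ^ 3 / 4) (by linarith) hx hmono (fun s hs => ?_) hT t
    ⟨ht, le_rfl⟩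
  linarith [cubic_le_of_mem_Icc (h s) hθ.le (hk s hs.1)]

lemma mem_quadrant_of_crossing {k₁ k₂ : ℝ → ℝ} {β₀ q C τ : ℝ} (h : ∀ t, |α t| < √(β t + 1))
    (hx : IsIntegralCurve x fun t => planarField (α t) (β t)) (hβ : Tendsto β atBot (𝓝 β₀))
    (hlim : Tendsto x atBot (𝓝 !₂[√(β₀ + 1), √(β₀ + 1)])) (hθ : 0 < θ) (hC : 0 ≤ C) (hτ : 0 ≤ τ)
    (hmono₁ : Monotone fun t => k₁ t + θ ^ 3 / 4 * t) (hk₁ : ∀ t ≤ 0, √(β t + 1) + θ ≤ k₁ t)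
    (hq₁ : k₁ 0 ≤ q) (hq₂ : q + C * τ ≤ k₂ τ)
    (hcubic : ∀ t, ∀ u ∈ Icc q (q + C * τ), cubic (α t) (β t) u + θ ^ 3 / 2 < C)
    (hmono₂ : Monotone fun t => k₂ t + θ ^ 3 / 4 * t)
    (hk₂ : ∀ t ≥ τ, k₂ t ∈ Icc (-√(β t + 1) + θ) (α t - θ)) :
    ∀ t ≥ τ, x t ∈ quadrant (k₂ t) (θ ^ 3 / 2) :=
  have hbefore := quadrant_mono hq₁ (mem_quadrant_of_tendsto_atBot h hx hβ hlim hθ hmono₁ hk₁)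
  have hrush := mem_quadrant_of_mem_Icc (by positivity) hC hτ hx hcubic hbefore
  mem_quadrant_of_mem_quadrant h hθ hx hmono₂ hk₂ (quadrant_mono hq₂ hrush)

end Barriers

section SlowDrift

variable {Λ a b f : ℝ → ℝ} {lm lp θ κ : ℝ}

lemma IsParameterShift.eventually_exists_envelope (hΛ : IsParameterShift Λ lm lp)
    (hf : ContinuousOn f (Icc lm lp)) (hθ : 0 < θ) (hκ : 0 < κ) :
    ∀ᶠ ε in 𝓝[>] (0 : ℝ), ∀ s, ∃ k : ℝ → ℝ, Monotone (fun t => k t + κ * t) ∧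
      ∀ t, k t ∈ Icc (f (Λ (s + ε * t))) (f (Λ (s + ε * t)) + θ) := by
  obtain ⟨L, hfL⟩ := hΛ.exists_abs_comp_sub_le hf hθ
  have hslow : ∀ᶠ ε in 𝓝[>] (0 : ℝ), L * ε < κ :=
    nhdsWithin_le_nhds (((continuous_const_mul L).tendsto' 0 0 (mul_zero L)).eventually_lt_const hκ)
  filter_upwards [hslow, self_mem_nhdsWithin] with ε hε hε0 s
  obtain ⟨k, hk, hbounds⟩ := exists_monotone_between
    (f := fun t => f (Λ (s + ε * t)) + κ * t) (g := fun t => f (Λ (s + ε * t)) + θ + κ * t)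
    fun t u htu => by
      have hdist : |s + ε * t - (s + ε * u)| = ε * (u - t) := by
        rw [add_sub_add_left_eq_sub, ← mul_sub, abs_mul, abs_of_pos hε0, abs_sub_comm,
          abs_of_nonneg (sub_nonneg.2 htu)]
      have hle := (le_abs_self _).trans (hfL (s + ε * t) (s + ε * u))
      have hdrift : L * (ε * (u - t)) ≤ κ * (u - t) := by
        rw [← mul_assoc]
        exact mul_le_mul_of_nonneg_right hε.le (sub_nonneg.2 htu)
      rw [hdist] at hle
      linarith
  refine ⟨fun t => k t - κ * t, by simpa using hk, fun t => ?_⟩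
  exact ⟨le_sub_iff_add_le.2 (hbounds t).1, sub_le_iff_le_add.2 (hbounds t).2⟩

lemma exists_clearance (ha : ContinuousOn a (Icc lm lp)) (hb : ContinuousOn b (Icc lm lp))
    (hab : ∀ l ∈ Icc lm lp, |a l| < √(b l + 1)) {d : ℝ} (hd : 0 < d) :
    ∃ θ > 0, θ ≤ 1 ∧ 5 * θ ≤ d ∧ ∀ l ∈ Icc lm lp, 3 * θ ≤ a l + √(b l + 1) := by
  have hc : ContinuousOn (fun l => a l + √(b l + 1)) (Icc lm lp) :=
    ha.add (hb.add continuousOn_const).sqrt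
  obtain ⟨g, hg, hmin⟩ := isCompact_Icc.exists_forall_le' hc (a := 0) fun l hl => by
    linarith [(abs_lt.1 (hab l hl)).1]
  have h₁ := min_le_right 1 (min (d / 5) (g / 3))
  refine ⟨min 1 (min (d / 5) (g / 3)), by positivity, min_le_left _ _, ?_, fun l hl => ?_⟩
  · linarith [h₁.trans (min_le_left _ _)]
  · linarith [h₁.trans (min_le_right _ _), hmin l hl]

lemma exists_cubic_lt (ha : ContinuousOn a (Icc lm lp)) (hb : ContinuousOn b (Icc lm lp))
    (p q : ℝ) : ∃ C > 0, ∀ l ∈ Icc lm lp, ∀ u ∈ Icc p q, cubic (a l) (b l) u < C := by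
  have hcont : ContinuousOn (fun z : ℝ × ℝ => cubic (a z.1) (b z.1) z.2)
      (Icc lm lp ×ˢ Icc p q) :=
    continuous_cubic.comp_continuousOn (((ha.comp continuousOn_fst fun _ hz => hz.1).prodMk
      (hb.comp continuousOn_fst fun _ hz => hz.1)).prodMk continuousOn_snd)
  obtain ⟨C, hC⟩ := (isCompact_Icc.prod isCompact_Icc).exists_bound_of_continuousOn hcont
  refine ⟨max C 0 + 1, by positivity, fun l hl u hu => ?_⟩
  linarith [(le_abs_self _).trans (hC (l, u) ⟨hl, hu⟩), le_max_left C 0]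

end SlowDrift

section Rush

variable {Λ a b : ℝ → ℝ} {lm lp s₁ s₂ ε τ : ℝ}

/-- The time change that runs at speed `ε`, except for a rush from `s₁` to `s₂` during
`[0, τ]`. -/
def rush (s₁ s₂ ε τ t : ℝ) : ℝ :=
  (s₂ - s₁ - ε * τ) * Real.smoothTransition (t / τ) + (s₁ + ε * t)

lemma rush_of_nonpos (hτ : 0 < τ) {t : ℝ} (ht : t ≤ 0) : rush s₁ s₂ ε τ t = s₁ + ε * t := by
  rw [rush, Real.smoothTransition.zero_of_nonpos (div_nonpos_of_nonpos_of_nonneg ht hτ.le)]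
  ring

lemma rush_of_ge (hτ : 0 < τ) {t : ℝ} (ht : τ ≤ t) :
    rush s₁ s₂ ε τ t = s₂ + ε * (t - τ) := by
  rw [rush, Real.smoothTransition.one_of_one_le ((one_le_div hτ).2 ht)]
  ring

lemma rush_zero (hτ : 0 < τ) : rush s₁ s₂ ε τ 0 = s₁ := by
  rw [rush_of_nonpos hτ le_rfl, mul_zero, add_zero]

lemma rush_self (hτ : 0 < τ) : rush s₁ s₂ ε τ τ = s₂ := by
  rw [rush_of_ge hτ le_rfl, sub_self, mul_zero, add_zero]

lemma contDiff_rush : ContDiff ℝ 2 (rush s₁ s₂ ε τ) := by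
  unfold rush
  have h : ContDiff ℝ 2 Real.smoothTransition := Real.smoothTransition.contDiff
  exact (contDiff_const.mul (h.comp (contDiff_id.div_const τ))).add
    (contDiff_const.add (contDiff_const.mul contDiff_id))

lemma isRescaling_rush (hε : 0 < ε) (hτ : 0 < τ) (h : ε * τ < s₂ - s₁) :
    IsRescaling (rush s₁ s₂ ε τ) where
  contDiff := contDiff_rush
  deriv_pos t := by
    have hmono : Monotone fun t => (s₂ - s₁ - ε * τ) * Real.smoothTransition (t / τ) :=
      (Real.smoothTransition.monotone.comp fun x y hxy =>
        div_le_div_of_nonneg_right hxy hτ.le).const_mul (by linarith)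
    have hS : ContDiff ℝ 2 Real.smoothTransition := Real.smoothTransition.contDiff
    have hd : DifferentiableAt ℝ
        (fun t => (s₂ - s₁ - ε * τ) * Real.smoothTransition (t / τ)) t :=
      ((contDiff_const.mul (hS.comp (contDiff_id.div_const τ))).differentiable
        two_ne_zero).differentiableAt
    have hlin : HasDerivAt (fun t : ℝ => s₁ + ε * t) ε t := by
      simpa using ((hasDerivAt_id t).const_mul ε).const_add s₁
    have := (hd.hasDerivAt.add hlin).deriv
    rw [show rush s₁ s₂ ε τ = (fun t => (s₂ - s₁ - ε * τ) * Real.smoothTransition (t / τ)) +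
      fun t => s₁ + ε * t from rfl, this]
    linarith [hmono.deriv_nonneg (x := t)]
  tendsto_atBot := by
    refine Tendsto.congr' (f₁ := fun t => s₁ + ε * t) ?_ ?_
    · filter_upwards [eventually_le_atBot 0] with t ht using (rush_of_nonpos hτ ht).symm
    · exact tendsto_atBot_add_const_left _ _ (tendsto_id.const_mul_atBot hε)
  tendsto_atTop := by
    refine Tendsto.congr' (f₁ := fun t => s₂ + ε * (t - τ)) ?_ ?_
    · filter_upwards [eventually_ge_atTop τ] with t ht using (rush_of_ge hτ ht).symm
    · exact tendsto_atTop_add_const_left _ _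
        ((tendsto_atTop_add_const_right _ (-τ) tendsto_id).const_mul_atTop hε)

lemma deriv_rush_of_neg (hτ : 0 < τ) {t : ℝ} (ht : t < 0) :
    deriv (rush s₁ s₂ ε τ) t = ε := by
  have hlin : HasDerivAt (fun t : ℝ => s₁ + ε * t) ε t := by
    simpa using ((hasDerivAt_id t).const_mul ε).const_add s₁
  refine (hlin.congr_of_eventuallyEq ?_).deriv
  filter_upwards [Iio_mem_nhds ht] with x hx using rush_of_nonpos hτ (le_of_lt hx)

lemma deriv_rush_of_gt (hτ : 0 < τ) {t : ℝ} (ht : τ < t) :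
    deriv (rush s₁ s₂ ε τ) t = ε := by
  have hlin : HasDerivAt (fun t : ℝ => s₂ + ε * (t - τ)) ε t := by
    simpa using (((hasDerivAt_id t).sub_const τ).const_mul ε).const_add s₂
  refine (hlin.congr_of_eventuallyEq ?_).deriv
  filter_upwards [Ioi_mem_nhds ht] with x hx using rush_of_ge hτ (le_of_lt hx)

lemma IsParameterShift.comp_rush (hΛ : IsParameterShift Λ lm lp) (hε : 0 < ε) (hτ : 0 < τ)
    (h : ε * τ < s₂ - s₁) : IsParameterShift (Λ ∘ rush s₁ s₂ ε τ) lm lp := by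
  have hσ := isRescaling_rush hε hτ h
  have hder : ∀ t, deriv (Λ ∘ rush s₁ s₂ ε τ) t =
      deriv Λ (rush s₁ s₂ ε τ t) * deriv (rush s₁ s₂ ε τ) t := fun t =>
    deriv_comp t (hΛ.contDiff.differentiable two_ne_zero _)
      (contDiff_rush.differentiable two_ne_zero _)
  refine ⟨hΛ.contDiff.comp hσ.contDiff, fun s => hΛ.mem_Ioo _,
    hΛ.tendsto_atBot.comp hσ.tendsto_atBot, hΛ.tendsto_atTop.comp hσ.tendsto_atTop, ?_, ?_⟩
  · have h1 : Tendsto (fun t => deriv Λ (rush s₁ s₂ ε τ t) * ε) atBot (𝓝 0) := by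
      simpa using (hΛ.deriv_atBot.comp hσ.tendsto_atBot).mul_const ε
    refine h1.congr' ?_
    filter_upwards [eventually_lt_atBot 0] with t ht
    rw [hder, deriv_rush_of_neg hτ ht]
  · have h1 : Tendsto (fun t => deriv Λ (rush s₁ s₂ ε τ t) * ε) atTop (𝓝 0) := by
      simpa using (hΛ.deriv_atTop.comp hσ.tendsto_atTop).mul_const ε
    refine h1.congr' ?_
    filter_upwards [eventually_gt_atTop τ] with t ht
    rw [hder, deriv_rush_of_gt hτ ht]

lemma IsParameterShift.exists_rush_envelopes {f g : ℝ → ℝ} {θ κ : ℝ}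
    (hΛ : IsParameterShift Λ lm lp) (hf : ContinuousOn f (Icc lm lp))
    (hg : ContinuousOn g (Icc lm lp)) (h12 : s₁ < s₂) (hτ : 0 < τ) (hθ : 0 < θ) (hκ : 0 < κ) :
    ∃ ε > 0, ε * τ < s₂ - s₁ ∧
      (∃ k : ℝ → ℝ, Monotone (fun t => k t + κ * t) ∧ ∀ t ≤ 0,
        k t ∈ Icc (f (Λ (rush s₁ s₂ ε τ t))) (f (Λ (rush s₁ s₂ ε τ t)) + θ)) ∧
      ∃ k : ℝ → ℝ, Monotone (fun t => k t + κ * t) ∧ ∀ t ≥ τ,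
        k t ∈ Icc (g (Λ (rush s₁ s₂ ε τ t))) (g (Λ (rush s₁ s₂ ε τ t)) + θ) := by
  have hshort : ∀ᶠ ε in 𝓝[>] (0 : ℝ), ε * τ < s₂ - s₁ :=
    nhdsWithin_le_nhds (((continuous_mul_const τ).tendsto' 0 0 (zero_mul τ)).eventually_lt_const
      (sub_pos.2 h12))
  obtain ⟨ε, hε, hετ, hbefore, hafter⟩ := (eventually_mem_nhdsWithin.and (hshort.and
    ((hΛ.eventually_exists_envelope hf hθ hκ).and
      (hΛ.eventually_exists_envelope hg hθ hκ)))).exists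
  obtain ⟨k₁, hk₁mono, hk₁⟩ := hbefore s₁
  obtain ⟨k₂, hk₂mono, hk₂⟩ := hafter (s₂ - ε * τ)
  refine ⟨ε, hε, hετ, ⟨k₁, hk₁mono, fun t ht => ?_⟩, k₂, hk₂mono, fun t ht => ?_⟩
  · rw [rush_of_nonpos hτ ht]
    exact hk₁ t
  · rw [rush_of_ge hτ ht, show s₂ + ε * (t - τ) = s₂ - ε * τ + ε * t by ring]
    exact hk₂ t

lemma exists_forall_apply_le_of_rush (hΛ : IsParameterShift Λ lm lp)
    (ha : ContinuousOn a (Icc lm lp)) (hb : ContinuousOn b (Icc lm lp))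
    (hab : ∀ l ∈ Icc lm lp, |a l| < √(b l + 1)) (h12 : s₁ < s₂)
    (hcross : √(b (Λ s₁) + 1) < a (Λ s₂)) :
    ∃ θ > 0, ∃ ε > 0, ∃ τ > 0, ε * τ < s₂ - s₁ ∧ ∀ x, EmanatesFrom (F a b)
      (Λ ∘ rush s₁ s₂ ε τ) 1 (p₃ b lm) x → ∀ t ≥ τ, x t 0 ≤ a (Λ (rush s₁ s₂ ε τ t)) - θ := by
  obtain ⟨θ, hθ, hθ1, hθcross, hθgap⟩ := exists_clearance ha hb hab (sub_pos.2 hcross)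
  have hθ3 : θ ^ 3 / 2 ≤ 1 := by linarith [pow_le_one₀ hθ.le hθ1 (n := 3)]
  obtain ⟨q, hq⟩ : ∃ q, q = √(b (Λ s₁) + 1) + 2 * θ := ⟨_, rfl⟩
  obtain ⟨C, hC, hcubic⟩ := exists_cubic_lt ha hb q (q + θ)
  obtain ⟨τ, hτ, hCτ⟩ : ∃ τ > 0, (C + 1) * τ = θ :=
    ⟨θ / (C + 1), by positivity, mul_div_cancel₀ _ (by positivity)⟩
  obtain ⟨ε, hε, hετ, ⟨k₁, hk₁mono, hk₁⟩, k₂, hk₂mono, hk₂⟩ := hΛ.exists_rush_envelopes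
    (f := fun l => √(b l + 1) + θ) (g := fun l => a l - 2 * θ) (κ := θ ^ 3 / 4)
    ((hb.add continuousOn_const).sqrt.add continuousOn_const) (ha.sub continuousOn_const)
    h12 hτ hθ (by positivity)
  refine ⟨θ, hθ, ε, hε, τ, hτ, hετ, fun x hx t ht => ?_⟩
  obtain ⟨hcurve, hlim⟩ := emanatesFrom_F_iff.1 hx
  simp only [Function.comp_apply, one_mul] at hcurve
  have hl := fun t => hΛ.mem_Icc (rush s₁ s₂ ε τ t)
  have hbefore : k₁ 0 ≤ q := by
    have := (hk₁ 0 le_rfl).2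
    rw [rush_zero hτ] at this
    linarith
  have hafter : q + (C + 1) * τ ≤ k₂ τ := by
    have := (hk₂ τ le_rfl).1
    rw [rush_self hτ] at this
    linarith
  have hquadrant := mem_quadrant_of_crossing (fun t => hab _ (hl t)) hcurve
    ((hΛ.comp_rush hε hτ hετ).tendsto_comp_atBot hb) hlim hθ (by positivity) hτ.le hk₁mono
    (fun t ht => (hk₁ t ht).1) hbefore hafter
    (fun t u hu => by linarith [hcubic _ (hl t) u ⟨hu.1, hu.2.trans_eq (by rw [hCτ])⟩]) hk₂mono
    (fun t ht => ⟨by linarith [(hk₂ t ht).1, hθgap _ (hl t)], by linarith [(hk₂ t ht).2]⟩) t ht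
  linarith [(mem_quadrant.1 hquadrant).1, (hk₂ t ht).2]

lemma rTippingPossible_p₃ (hΛ : IsParameterShift Λ lm lp)
    (ha : ContinuousOn a (Icc lm lp)) (hb : ContinuousOn b (Icc lm lp))
    (hab : ∀ l ∈ Icc lm lp, |a l| < √(b l + 1)) (h12 : s₁ < s₂)
    (hcross : √(b (Λ s₁) + 1) < a (Λ s₂)) :
    RTippingPossible (F a b) Λ lm lp (fun s => p₃ b (Λ s)) (p₃ b lm) (p₃ b lp) := by
  obtain ⟨θ, hθ, ε, hε, τ, hτ, hετ, hbound⟩ :=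
    exists_forall_apply_le_of_rush hΛ ha hb hab h12 hcross
  have hshift := hΛ.comp_rush hε hτ hετ
  obtain ⟨x, hx⟩ := exists_isPullbackAttractor_p₃ hshift ha hb hab one_pos
  refine ⟨isStablePath_p₃ hΛ hb hab, rush s₁ s₂ ε τ, isRescaling_rush hε hτ hετ, hshift, 1,
    one_pos, x, hx, fun hlim => ?_⟩
  have hlim0 : Tendsto (fun t => x t 0) atTop (𝓝 √(b lp + 1)) :=
    ((EuclideanSpace.proj (𝕜 := ℝ) 0).continuous.tendsto _).comp hlim
  have hle : √(b lp + 1) ≤ a lp - θ :=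
    le_of_tendsto_of_tendsto hlim0 ((hshift.tendsto_comp_atTop ha).sub_const θ)
      ((eventually_ge_atTop τ).mono fun t ht => hbound x hx.1 t ht)
  linarith [(abs_lt.1 (hab lp (right_mem_Icc.2 hΛ.le))).2]

end Rush

section Dichotomy

variable {Λ a b : ℝ → ℝ} {lm lp s₁ s₂ : ℝ}

lemma rTippingPossible_p₁ (hΛ : IsParameterShift Λ lm lp)
    (ha : ContinuousOn a (Icc lm lp)) (hb : ContinuousOn b (Icc lm lp))
    (hab : ∀ l ∈ Icc lm lp, |a l| < √(b l + 1)) (h12 : s₁ < s₂)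
    (hcross : a (Λ s₂) < -√(b (Λ s₁) + 1)) :
    RTippingPossible (F a b) Λ lm lp (fun s => p₁ b (Λ s)) (p₁ b lm) (p₁ b lp) := by
  have h := (rTippingPossible_p₃ (a := -a) hΛ ha.neg hb (by simpa using hab) h12
    (lt_neg.1 hcross)).reflect
  simpa only [reflect_F, neg_neg, neg_p₃] using h

lemma isForwardInflowingStable_and_noRTipping_p₁ (hΛ : IsParameterShift Λ lm lp)
    (ha : ContinuousOn a (Icc lm lp)) (hb : ContinuousOn b (Icc lm lp))
    (hab : ∀ l ∈ Icc lm lp, |a l| < √(b l + 1))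
    (h : ∀ s₁ s₂, s₁ < s₂ → -√(b (Λ s₁) + 1) < a (Λ s₂))
    (hbot : ∀ s₂, -√(b lm + 1) < a (Λ s₂)) (htop : ∀ s₁, -√(b (Λ s₁) + 1) < a lp)
    (hbt : -√(b lm + 1) < a lp) :
    IsForwardInflowingStable (F a b) Λ lm lp (fun s => p₁ b (Λ s)) (p₁ b lm) (p₁ b lp) ∧
      NoRTipping (F a b) Λ (p₁ b lm) (p₁ b lp) := by
  obtain ⟨η, hη, hgap⟩ := hΛ.exists_gap ha (hb.add continuousOn_const).sqrt
    (fun l hl => neg_lt_iff_pos_add.1 (abs_lt.1 (hab l hl)).1)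
    (fun s₁ s₂ hs => neg_lt_iff_pos_add.1 (h s₁ s₂ hs))
    (fun s => neg_lt_iff_pos_add.1 (hbot s)) (fun s => neg_lt_iff_pos_add.1 (htop s))
    (neg_lt_iff_pos_add.1 hbt)
  obtain ⟨θ, k, hk⟩ := exists_isSeparating hη hgap
  exact ⟨hk.isForwardInflowingStable hΛ ha hb hab, hk.noRTipping hΛ ha hb hab⟩

lemma isForwardInflowingStable_and_noRTipping_p₃ (hΛ : IsParameterShift Λ lm lp)
    (ha : ContinuousOn a (Icc lm lp)) (hb : ContinuousOn b (Icc lm lp))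
    (hab : ∀ l ∈ Icc lm lp, |a l| < √(b l + 1))
    (h : ∀ s₁ s₂, s₁ < s₂ → a (Λ s₂) < √(b (Λ s₁) + 1))
    (hbot : ∀ s₂, a (Λ s₂) < √(b lm + 1)) (htop : ∀ s₁, a lp < √(b (Λ s₁) + 1))
    (hbt : a lp < √(b lm + 1)) :
    IsForwardInflowingStable (F a b) Λ lm lp (fun s => p₃ b (Λ s)) (p₃ b lm) (p₃ b lp) ∧
      NoRTipping (F a b) Λ (p₃ b lm) (p₃ b lp) := by
  have h := isForwardInflowingStable_and_noRTipping_p₁ (a := -a) hΛ ha.neg hb (by simpa using hab)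
    (fun s₁ s₂ hs => neg_lt_neg (h s₁ s₂ hs)) (fun s => neg_lt_neg (hbot s))
    (fun s => neg_lt_neg (htop s)) (neg_lt_neg hbt)
  simpa only [reflect_F, neg_neg, neg_p₁] using And.intro h.1.reflect h.2.reflect

end Dichotomy

end RTipping

end

theorem proposition6p1_general (lm lp : ℝ) (Λ : ℝ → ℝ) (hΛ : RTipping.IsParameterShift Λ lm lp)
    (a b : ℝ → ℝ) (ha : ContinuousOn a (Set.Icc lm lp)) (hb : ContinuousOn b (Set.Icc lm lp))
    (hab : ∀ l ∈ Set.Icc lm lp, |a l| < √(b l + 1)) :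
    ((∃ s₁ s₂, s₁ < s₂ ∧ -√(b (Λ s₁) + 1) > a (Λ s₂)) →
      RTipping.RTippingPossible (RTipping.F a b) Λ lm lp
        (fun s => RTipping.p₁ b (Λ s)) (RTipping.p₁ b lm) (RTipping.p₁ b lp)) ∧
    ((∃ s₁ s₂, s₁ < s₂ ∧ √(b (Λ s₁) + 1) < a (Λ s₂)) →
      RTipping.RTippingPossible (RTipping.F a b) Λ lm lp
        (fun s => RTipping.p₃ b (Λ s)) (RTipping.p₃ b lm) (RTipping.p₃ b lp)) ∧
    ((∀ s₁ s₂, s₁ < s₂ → -√(b (Λ s₁) + 1) < a (Λ s₂)) →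
      (∀ s₂, -√(b lm + 1) < a (Λ s₂)) →
      (∀ s₁, -√(b (Λ s₁) + 1) < a lp) →
      -√(b lm + 1) < a lp →
      RTipping.IsForwardInflowingStable (RTipping.F a b) Λ lm lp
        (fun s => RTipping.p₁ b (Λ s)) (RTipping.p₁ b lm) (RTipping.p₁ b lp) ∧
      RTipping.NoRTipping (RTipping.F a b) Λ (RTipping.p₁ b lm) (RTipping.p₁ b lp)) ∧
    ((∀ s₁ s₂, s₁ < s₂ → √(b (Λ s₁) + 1) > a (Λ s₂)) →
      (∀ s₂, √(b lm + 1) > a (Λ s₂)) →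
      (∀ s₁, √(b (Λ s₁) + 1) > a lp) →
      √(b lm + 1) > a lp →
      RTipping.IsForwardInflowingStable (RTipping.F a b) Λ lm lp
        (fun s => RTipping.p₃ b (Λ s)) (RTipping.p₃ b lm) (RTipping.p₃ b lp) ∧
      RTipping.NoRTipping (RTipping.F a b) Λ (RTipping.p₃ b lm) (RTipping.p₃ b lp)) :=
  ⟨fun ⟨_, _, h12, h⟩ => RTipping.rTippingPossible_p₁ hΛ ha hb hab h12 h,
    fun ⟨_, _, h12, h⟩ => RTipping.rTippingPossible_p₃ hΛ ha hb hab h12 h,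
    RTipping.isForwardInflowingStable_and_noRTipping_p₁ hΛ ha hb hab,
    RTipping.isForwardInflowingStable_and_noRTipping_p₃ hΛ ha hb hab⟩

theorem proposition6p1 (lm lp : ℝ) (hl : lm < lp)
    (Λ : ℝ → ℝ) (hΛ : RTipping.IsParameterShift Λ lm lp)
    (a b : ℝ → ℝ) (ha : ContDiffOn ℝ 2 a (Set.Icc lm lp)) (hb : ContDiffOn ℝ 2 b (Set.Icc lm lp))
    (hb1 : ∀ l ∈ Set.Icc lm lp, -1 < b l)
    (hab : ∀ l ∈ Set.Icc lm lp, |a l| < √(b l + 1)) :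
    ((∃ s₁ s₂, s₁ < s₂ ∧ -√(b (Λ s₁) + 1) > a (Λ s₂)) →
      RTipping.RTippingPossible (RTipping.F a b) Λ lm lp
        (fun s => RTipping.p₁ b (Λ s)) (RTipping.p₁ b lm) (RTipping.p₁ b lp)) ∧
    ((∃ s₁ s₂, s₁ < s₂ ∧ √(b (Λ s₁) + 1) < a (Λ s₂)) →
      RTipping.RTippingPossible (RTipping.F a b) Λ lm lp
        (fun s => RTipping.p₃ b (Λ s)) (RTipping.p₃ b lm) (RTipping.p₃ b lp)) ∧
    ((∀ s₁ s₂, s₁ < s₂ → -√(b (Λ s₁) + 1) < a (Λ s₂)) →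
      (∀ s₂, -√(b lm + 1) < a (Λ s₂)) →
      (∀ s₁, -√(b (Λ s₁) + 1) < a lp) →
      -√(b lm + 1) < a lp →
      RTipping.IsForwardInflowingStable (RTipping.F a b) Λ lm lp
        (fun s => RTipping.p₁ b (Λ s)) (RTipping.p₁ b lm) (RTipping.p₁ b lp) ∧
      RTipping.NoRTipping (RTipping.F a b) Λ (RTipping.p₁ b lm) (RTipping.p₁ b lp)) ∧
    ((∀ s₁ s₂, s₁ < s₂ → √(b (Λ s₁) + 1) > a (Λ s₂)) →
      (∀ s₂, √(b lm + 1) > a (Λ s₂)) →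
      (∀ s₁, √(b (Λ s₁) + 1) > a lp) →
      √(b lm + 1) > a lp →
      RTipping.IsForwardInflowingStable (RTipping.F a b) Λ lm lp
        (fun s => RTipping.p₃ b (Λ s)) (RTipping.p₃ b lm) (RTipping.p₃ b lp) ∧
      RTipping.NoRTipping (RTipping.F a b) Λ (RTipping.p₃ b lm) (RTipping.p₃ b lp)) :=
  proposition6p1_general lm lp Λ hΛ a b ha.continuousOn hb.continuousOn hab
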